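/- **Theorem 1.** For every $n$ let $C^*$ be a uniformly random set of $K=K_n\le n$ of the nodes $1,\dots,n$, with labels $x^*_i=1$ if $i\in C^*$ and $x^*_i=0$ otherwise. Given $C^*$, one observes a random graph $G$ in which every pair of nodes is joined, independently, with probability $p=p_n$ if both nodes lie in $C^*$ and with probability $q=q_n$ otherwise, and, independently of $G$, side information $Y=(y_{i,m})_{i\le n,\,m\le M}$ consisting of $M=M_n$ features per node, all independent, with $y_{i,m}\sim V$ if $i\in C^*$ and $y_{i,m}\sim U$ if $i\notin C^*$. The probability distributions $U,V$ do not depend on $n$, are mutually absolutely continuous, and the log-likelihood ratio $\log\frac{dV}{dU}$ is bounded. Assume that, as $n\to\infty$, $K\to\infty$, $K=o(n)$, $p\ge q$, $p/q=\Theta(1)$ and $\limsup p<1$. Let $P,Q$ be the Bernoulli distributions with parameters $p,q$, and let $D(\cdot\|\cdot)$ be the Kullback–Leibler divergence (natural logarithm). Weak recovery is *achievable* if there are estimators $\hat x=\hat x_n(G,Y)\in\{0,1\}^n$ such that $d(\hat x,x^*)/K\to0$ in probability, where $d$ is the Hamming distance. 1. (Sufficiency) If $$(K-1)D(P\|Q)+M\,D(V\|U)\to\infty\quad\text{and}\quad\liminf_{n\to\infty}\frac{(K-1)D(P\|Q)+2M\,D(V\|U)}{\log(n/K)}>2,$$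 then weak recovery is achievable. 2. (Necessity) If weak recovery is achievable, then $$(K-1)D(P\|Q)+M\,D(V\|U)\to\infty\quad\text{and}\quad\liminf_{n\to\infty}\frac{(K-1)D(P\|Q)+2M\,D(V\|U)}{\log(n/K)}\ge2.$$ In particular, unless the lower limit equals exactly $2$, weak recovery is achievable if and only if the two conditions in part 1 hold. -/

import Mathlib

open MeasureTheory ProbabilityTheory Filter Topology Asymptotics InformationTheory

noncomputable section

namespace SingleCommunity

/-- Label vectors of `n` nodes: `x i = true` means that node `i` is in the community. -/
abbrev Labels (n : ℕ) : Type := Fin n → Bool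

/-- Unordered pairs of distinct nodes, each written in increasing order. -/
abbrev Pair (n : ℕ) : Type := {e : Fin n × Fin n // e.1 < e.2}

/-- A simple graph on `n` nodes, given by the edge indicators `G_{ij}`, `i < j`. -/
abbrev GraphObs (n : ℕ) : Type := Pair n → Bool

/-- The side information `y_{i,m}`: `M` features with values in `𝓨` for each of the `n` nodes. -/
abbrev SideObs (𝓨 : Type*) (n M : ℕ) : Type _ := Fin n → Fin M → 𝓨

/-- The label vectors whose community has exactly `K` members. -/
def communities (n K : ℕ) : Set (Labels n) :=
  {x | (Finset.univ.filter fun i => x i = true).card = K}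

/-- The Bernoulli distribution with success probability `p`. -/
def bern (p : unitInterval) : Measure Bool := bernoulliMeasure true false p

instance (p : unitInterval) : IsProbabilityMeasure (bern p) := by
  unfold bern; infer_instance

/-- Law of the graph given the labels: independent edges, present with probability `p` if both
end points are in the community and with probability `q` otherwise. -/
def graphLaw (n : ℕ) (p q : unitInterval) (x : Labels n) : Measure (GraphObs n) :=
  Measure.pi fun e => if x e.1.1 = true ∧ x e.1.2 = true then bern p else bern q

variable {𝓨 : Type*} [MeasurableSpace 𝓨]

/-- Law of the side information given the labels: independent features, with law `V` at nodes of
the community and law `U` at the other nodes. -/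
def sideLaw (n M : ℕ) (V U : Measure 𝓨) (x : Labels n) : Measure (SideObs 𝓨 n M) :=
  Measure.pi fun i => Measure.pi fun _ => if x i = true then V else U

/-- Law of the observation (graph and side information, independent given the labels). -/
def obsKernel (n M : ℕ) (p q : unitInterval) (V U : Measure 𝓨) :
    Kernel (Labels n) (GraphObs n × SideObs 𝓨 n M) :=
  Kernel.ofFunOfCountable fun x => (graphLaw n p q x).prod (sideLaw n M V U x)

/-- Joint law of the true labels and the observation. The true community is uniformly distributed
over the sets of `K` nodes. -/
def jointLaw (n K M : ℕ) (p q : unitInterval) (V U : Measure 𝓨) :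
    Measure (Labels n × (GraphObs n × SideObs 𝓨 n M)) :=
  (uniformOn (communities n K)).compProd (obsKernel n M p q V U)

instance (n M : ℕ) (p q : unitInterval) (V U : Measure 𝓨) [IsProbabilityMeasure V]
    [IsProbabilityMeasure U] : IsMarkovKernel (obsKernel n M p q V U) := by
  refine ⟨fun x => ?_⟩
  have h1 : ∀ e : Pair n, IsProbabilityMeasure
      (if x e.1.1 = true ∧ x e.1.2 = true then bern p else bern q) := by
    intro e; split_ifs <;> infer_instance
  have h2 : ∀ i : Fin n, IsProbabilityMeasure (if x i = true then V else U) := by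
    intro i; split_ifs <;> infer_instance
  change IsProbabilityMeasure ((graphLaw n p q x).prod (sideLaw n M V U x))
  unfold graphLaw sideLaw
  infer_instance

/-- Weak recovery is achievable: some sequence of (measurable) estimators of the labels from the
graph and the side information has Hamming error `d` with `d / K → 0` in probability. -/
def WeakRecoveryAchievable (K M : ℕ → ℕ) (p q : ℕ → unitInterval) (V U : Measure 𝓨) : Prop :=
  ∃ xhat : (n : ℕ) → GraphObs n × SideObs 𝓨 n (M n) → Labels n,
    (∀ n, Measurable (xhat n)) ∧
    ∀ ε : ℝ, 0 < ε →
      Tendsto (fun n => jointLaw n (K n) (M n) (p n) (q n) V U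
        {z | ε < (hammingDist (xhat n z.2) z.1 : ℝ) / (K n : ℝ)}) atTop (𝓝 0)

/-- The log-likelihood ratio `log (dV/dU)` of one feature is finite and bounded. -/
def BoundedLLR (V U : Measure 𝓨) : Prop :=
  V ≪ U ∧ U ≪ V ∧ ∃ B : ℝ, ∀ᵐ y ∂U, |llr V U y| ≤ B

/-- `D(P‖Q)` for the Bernoulli distributions with parameters `p` and `q` (natural logarithm). -/
def edgeKL (p q : unitInterval) : ℝ := (klDiv (bern p) (bern q)).toReal

/-- `D(V‖U)` (natural logarithm). -/
def featureKL (V U : Measure 𝓨) : ℝ := (klDiv V U).toReal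

end SingleCommunity

end

open scoped ENNReal

namespace SingleCommunity

/-! ### Exponential moments of a bounded log-likelihood ratio -/

/-! A bounded log-likelihood ratio `L = log dP/dQ` has `E_P L = D(P‖Q)` and, because `E_P exp(-L) =
1`, also `E_P L² = O(D(P‖Q))`. Hence `E_Q exp((1+t)L) ≤ exp((t + C t²) D(P‖Q))` for `|t| ≤ 2`, with
`C` depending only on the bound (`LLRBoundedBy.expMoment_le`). The law given a community `x` has
density `exp (logLik x)` with respect to the law without community, and `logLik x` is a sum of
independent terms, so Chernoff bounds for edges and features together need only the two divergences.

Sufficiency: the maximum likelihood estimate `y` is compared with the truth `x` through the common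
part `w` (`obsKernel_error_le`). If `y` misses `l` members, the mean gain from `w` to `x` is at
least `l/2` times `R = (K-1)D(P‖Q) + 2M D(V‖U)`. The gain of `x` over `w` is rarely much smaller:
there are at most `2^K` sets `w`, and this is where the first condition enters. The gain of `y` over
`w` is pure noise and exceeds `θ` with probability at most `exp(-θ)`; this beats the number of
candidates `y`, roughly `(n/K)^l`, when `R/2` exceeds `log(n/K)` by a constant factor.

Necessity of the second condition is a volume argument (`one_le_error_add`): unless `logLik x`
exceeds `θ`, slightly above its mean `KR/2`, passing to the null law costs at most `exp θ`, whereas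
under the null law the estimate is close to only a fraction of about `(n/K)^(-K(1-ε))` of the
communities. Necessity of the first condition comes from exchanging a member with a non-member
(`one_sub_error_le`): if the information per node stays bounded, the two laws are comparable, so a
node marked reliably as a member would also be marked too often as a non-member. -/

lemma exp_le_one_add_add_sq_mul_exp_abs (y : ℝ) :
    Real.exp y ≤ 1 + y + y ^ 2 * Real.exp |y| := by
  have h1 : 1 ≤ Real.exp |y| := Real.one_le_exp (abs_nonneg y)
  rcases le_total |y| 1 with h | h
  · have := (abs_le.1 (Real.abs_exp_sub_one_sub_id_le h)).2
    nlinarith [sq_nonneg y]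
  · have h2 : 1 ≤ y ^ 2 := by rw [← sq_abs]; nlinarith
    rcases le_total 0 y with hy | hy
    · rw [abs_of_nonneg hy] at *
      nlinarith [Real.exp_pos y]
    · have h3 : Real.exp y ≤ 1 := Real.exp_le_one_iff.2 hy
      rw [abs_of_nonpos hy] at *
      nlinarith

/-- For `y ≥ -2`, squaring `1 + y/2 ≤ exp (y/2)` gives `y²/4`; below `-2` the linear term suffices
because `-y ≤ B`. This converse of the usual quadratic bound lets the divergence control the second
moment. -/
lemma sq_div_le_exp_sub_one_sub {y B : ℝ} (hB : |y| ≤ B) :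
    y ^ 2 / (4 + 2 * B) ≤ Real.exp y - 1 - y := by
  have hB0 : 0 ≤ B := (abs_nonneg y).trans hB
  have hd : 0 < 4 + 2 * B := by linarith
  rw [div_le_iff₀ hd]
  rcases le_total (-2) y with h | h
  · have h1 : y / 2 + 1 ≤ Real.exp (y / 2) := Real.add_one_le_exp _
    have h2 : Real.exp y = Real.exp (y / 2) ^ 2 := by
      rw [← Real.exp_nat_mul]; congr 1; push_cast; ring
    have h3 : (y / 2 + 1) ^ 2 ≤ Real.exp y := by
      rw [h2]; exact pow_le_pow_left₀ (by linarith) h1 2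
    nlinarith [sq_nonneg y]
  · have h1 : -y ≤ B := (neg_le_abs y).trans hB
    nlinarith [Real.exp_pos y]

variable {Ω : Type*} [MeasurableSpace Ω]

/-- `P` and `Q` are mutually absolutely continuous with log-likelihood ratio bounded by `B`. -/
structure LLRBoundedBy (P Q : Measure Ω) (B : ℝ) : Prop where
  ac : P ≪ Q
  ac' : Q ≪ P
  bound : ∀ᵐ y ∂Q, |llr P Q y| ≤ B

/-- The constant in the second order bound on the exponential moments. -/
noncomputable def cumulantConst (B : ℝ) : ℝ := (4 + 2 * B) * Real.exp (2 * B)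

lemma one_le_cumulantConst {B : ℝ} (hB : 0 ≤ B) : 1 ≤ cumulantConst B := by
  unfold cumulantConst
  have := Real.one_le_exp (show 0 ≤ 2 * B by linarith)
  nlinarith

/-- The exponential moment `E_Q exp (t log (dP/dQ))`. -/
noncomputable def expMoment (P Q : Measure Ω) (t : ℝ) : ℝ≥0∞ :=
  ∫⁻ y, ENNReal.ofReal (Real.exp (t * llr P Q y)) ∂Q

section

variable {P Q : Measure Ω} {B : ℝ}

@[simp] lemma expMoment_zero [IsProbabilityMeasure Q] : expMoment P Q 0 = 1 := by
  simp [expMoment]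

lemma LLRBoundedBy.nonneg [IsProbabilityMeasure Q] (h : LLRBoundedBy P Q B) : 0 ≤ B := by
  obtain ⟨y, hy⟩ := h.bound.exists
  exact (abs_nonneg _).trans hy

lemma LLRBoundedBy.mono (h : LLRBoundedBy P Q B) {B' : ℝ} (hB : B ≤ B') : LLRBoundedBy P Q B' :=
  ⟨h.ac, h.ac', h.bound.mono fun _ hy => hy.trans hB⟩

lemma LLRBoundedBy.bound' (h : LLRBoundedBy P Q B) : ∀ᵐ y ∂P, |llr P Q y| ≤ B :=
  h.ac.ae_le h.bound

variable [IsProbabilityMeasure P]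

lemma LLRBoundedBy.integrable_exp (h : LLRBoundedBy P Q B) (t : ℝ) :
    Integrable (fun y => Real.exp (t * llr P Q y)) P := by
  have hm := measurable_llr P Q
  refine Integrable.of_bound (C := Real.exp (|t| * B)) (by fun_prop) ?_
  filter_upwards [h.bound'] with y hy
  rw [Real.norm_eq_abs, Real.abs_exp, Real.exp_le_exp]
  calc t * llr P Q y ≤ |t * llr P Q y| := le_abs_self _
    _ = |t| * |llr P Q y| := abs_mul _ _
    _ ≤ |t| * B := by gcongr

lemma LLRBoundedBy.integrable_llr (h : LLRBoundedBy P Q B) : Integrable (llr P Q) P :=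
  Integrable.of_bound (C := B) (measurable_llr P Q).aestronglyMeasurable h.bound'

lemma LLRBoundedBy.integrable_llr_sq (h : LLRBoundedBy P Q B) :
    Integrable (fun y => llr P Q y ^ 2) P := by
  have hm := measurable_llr P Q
  refine Integrable.of_bound (C := B ^ 2) (by fun_prop) ?_
  filter_upwards [h.bound'] with y hy
  rw [Real.norm_eq_abs, abs_pow]
  gcongr

variable [IsProbabilityMeasure Q]

lemma LLRBoundedBy.withDensity_exp_llr (h : LLRBoundedBy P Q B) :
    Q.withDensity (fun y => ENNReal.ofReal (Real.exp (llr P Q y))) = P := by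
  conv_rhs => rw [← Measure.withDensity_rnDeriv_eq P Q h.ac]
  refine withDensity_congr_ae ?_
  filter_upwards [exp_llr_of_ac' P Q h.ac', Measure.rnDeriv_lt_top P Q] with y h1 h2
  rw [h1, ENNReal.ofReal_toReal h2.ne]

/-- One unit of the exponent is the density `dP/dQ`. Moments near `1` thus become moments near `0`
under `P`, where the mean is the divergence. -/
lemma LLRBoundedBy.expMoment_one_add (h : LLRBoundedBy P Q B) (t : ℝ) :
    expMoment P Q (1 + t) = ∫⁻ y, ENNReal.ofReal (Real.exp (t * llr P Q y)) ∂P := by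
  have hm := measurable_llr P Q
  have h1 : ∫⁻ y, ENNReal.ofReal (Real.exp (t * llr P Q y)) ∂P
      = ∫⁻ y, ENNReal.ofReal (Real.exp (t * llr P Q y))
        ∂(Q.withDensity fun y => ENNReal.ofReal (Real.exp (llr P Q y))) := by
    rw [h.withDensity_exp_llr]
  rw [h1, lintegral_withDensity_eq_lintegral_mul _ (by fun_prop) (by fun_prop)]
  refine lintegral_congr fun y => ?_
  simp only [Pi.mul_apply]
  rw [← ENNReal.ofReal_mul (Real.exp_pos _).le, ← Real.exp_add]
  ring_nf

lemma LLRBoundedBy.expMoment_one (h : LLRBoundedBy P Q B) : expMoment P Q 1 = 1 := by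
  have := h.expMoment_one_add 0
  simpa using this

lemma LLRBoundedBy.integral_llr (h : LLRBoundedBy P Q B) :
    ∫ y, llr P Q y ∂P = (klDiv P Q).toReal :=
  (toReal_klDiv_of_measure_eq h.ac (by simp)).symm

/-- Since `E_P exp(-L) = 1`, the divergence equals `E_P (exp(-L) - 1 + L)`, and this integrand
dominates `L²/(4 + 2B)`. -/
lemma LLRBoundedBy.integral_llr_sq_le (h : LLRBoundedBy P Q B) :
    ∫ y, llr P Q y ^ 2 ∂P ≤ (4 + 2 * B) * (klDiv P Q).toReal := by
  have hB := h.nonneg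
  have h1 : ∫ y, Real.exp (-1 * llr P Q y) ∂P = 1 := by
    rw [integral_eq_lintegral_of_nonneg_ae (ae_of_all _ fun _ => (Real.exp_pos _).le)
      (h.integrable_exp _).1, ← h.expMoment_one_add]
    simp
  have h2 : ∫ y, llr P Q y ^ 2 / (4 + 2 * B) ∂P
      ≤ ∫ y, (Real.exp (-1 * llr P Q y) - 1 + llr P Q y) ∂P := by
    refine integral_mono_ae (h.integrable_llr_sq.div_const _)
      (((h.integrable_exp _).sub (integrable_const _)).add h.integrable_llr) ?_
    filter_upwards [h.bound'] with y hy
    have := sq_div_le_exp_sub_one_sub (y := -1 * llr P Q y) (B := B) (by simpa using hy)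
    simp only [neg_mul, one_mul, even_two, Even.neg_pow, sub_neg_eq_add] at this ⊢
    exact this
  rw [integral_add (f := fun y => Real.exp (-1 * llr P Q y) - 1)
    ((h.integrable_exp _).sub (integrable_const _)) h.integrable_llr,
    integral_sub (h.integrable_exp _) (integrable_const _), h1, h.integral_llr,
    integral_div, div_le_iff₀ (by linarith)] at h2
  simp at h2
  linarith

/-- Second order bound on the exponential moments of the log-likelihood ratio near `1`. -/
lemma LLRBoundedBy.expMoment_le (h : LLRBoundedBy P Q B) {t : ℝ} (ht : |t| ≤ 2) :
    expMoment P Q (1 + t)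
      ≤ ENNReal.ofReal (Real.exp ((t + cumulantConst B * t ^ 2) * (klDiv P Q).toReal)) := by
  have hB := h.nonneg
  rw [h.expMoment_one_add, ← ofReal_integral_eq_lintegral_ofReal (h.integrable_exp t)
    (ae_of_all _ fun _ => (Real.exp_pos _).le)]
  refine ENNReal.ofReal_le_ofReal ?_
  have h1 : ∫ y, Real.exp (t * llr P Q y) ∂P
      ≤ ∫ y, (1 + t * llr P Q y + t ^ 2 * Real.exp (2 * B) * llr P Q y ^ 2) ∂P := by
    refine integral_mono_ae (h.integrable_exp t) (((integrable_const _).add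
      (h.integrable_llr.const_mul _)).add (h.integrable_llr_sq.const_mul _)) ?_
    filter_upwards [h.bound'] with y hy
    refine (exp_le_one_add_add_sq_mul_exp_abs _).trans ?_
    have : Real.exp |t * llr P Q y| ≤ Real.exp (2 * B) := by
      rw [Real.exp_le_exp, abs_mul]; gcongr
    have h3 : (t * llr P Q y) ^ 2 * Real.exp |t * llr P Q y|
        ≤ (t * llr P Q y) ^ 2 * Real.exp (2 * B) := by gcongr
    nlinarith
  rw [integral_add (f := fun y => 1 + t * llr P Q y)
    ((integrable_const _).add (h.integrable_llr.const_mul _)) (h.integrable_llr_sq.const_mul _),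
    integral_add (integrable_const _)
    (h.integrable_llr.const_mul _), integral_const_mul, integral_const_mul, h.integral_llr] at h1
  simp only [integral_const, probReal_univ, smul_eq_mul, mul_one] at h1
  have h2 : t ^ 2 * Real.exp (2 * B) * ∫ y, llr P Q y ^ 2 ∂P
      ≤ t ^ 2 * Real.exp (2 * B) * ((4 + 2 * B) * (klDiv P Q).toReal) := by
    gcongr; exact h.integral_llr_sq_le
  refine h1.trans (le_trans ?_ (Real.add_one_le_exp _))
  unfold cumulantConst
  linarith

end

/-! ### Integration against finite product measures -/

lemma lintegral_pi_prod {ι : Type*} [Fintype ι] {α : ι → Type*} [∀ i, MeasurableSpace (α i)]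
    (μ : ∀ i, Measure (α i)) [∀ i, IsProbabilityMeasure (μ i)] {φ : ∀ i, α i → ℝ≥0∞}
    (hφ : ∀ i, Measurable (φ i)) :
    ∫⁻ x, ∏ i, φ i (x i) ∂Measure.pi μ = ∏ i, ∫⁻ y, φ i y ∂μ i := by
  rw [lintegral_prod_eq_prod_lintegral_of_indepFun (μ := Measure.pi μ) Finset.univ
    (fun i x => φ i (x i)) (iIndepFun_pi fun i => (hφ i).aemeasurable)
    (fun i => (hφ i).comp (measurable_pi_apply i))]
  refine Finset.prod_congr rfl fun i _ => ?_
  exact (measurePreserving_eval μ i).lintegral_comp (hφ i)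

lemma pi_eq_withDensity {ι : Type*} [Fintype ι] {α : ι → Type*} [∀ i, MeasurableSpace (α i)]
    (μ ν : ∀ i, Measure (α i)) [∀ i, IsProbabilityMeasure (μ i)]
    [∀ i, IsProbabilityMeasure (ν i)] {φ : ∀ i, α i → ℝ≥0∞} (hφ : ∀ i, Measurable (φ i))
    (h : ∀ i, ν i = (μ i).withDensity (φ i)) :
    Measure.pi ν = (Measure.pi μ).withDensity fun x => ∏ i, φ i (x i) := by
  classical
  refine Measure.pi_eq fun s hs => ?_
  rw [withDensity_apply _ (MeasurableSet.univ_pi hs), ← lintegral_indicator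
    (MeasurableSet.univ_pi hs)]
  have h1 : (Set.univ.pi s).indicator (fun x => ∏ i, φ i (x i))
      = fun x => ∏ i, (s i).indicator (φ i) (x i) := by
    funext x
    by_cases hx : x ∈ Set.univ.pi s
    · rw [Set.indicator_of_mem hx]
      exact Finset.prod_congr rfl fun i _ => (Set.indicator_of_mem (hx i trivial) _).symm
    · rw [Set.indicator_of_notMem hx]
      simp only [Set.mem_univ_pi, not_forall] at hx
      obtain ⟨i, hi⟩ := hx
      exact (Finset.prod_eq_zero (Finset.mem_univ i) (Set.indicator_of_notMem hi _)).symm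
  rw [h1, lintegral_pi_prod μ fun i => (hφ i).indicator (hs i)]
  refine Finset.prod_congr rfl fun i _ => ?_
  rw [lintegral_indicator (hs i), h i, withDensity_apply _ (hs i)]

end SingleCommunity

namespace SingleCommunity

/-! ### The Bernoulli distributions -/

lemma bern_singleton_true (p : unitInterval) : bern p {true} = ENNReal.ofReal p := by
  classical
  rw [bern, bernoulliMeasure_apply _ (MeasurableSet.singleton _)]
  simp [ENNReal.ofReal, unitInterval.toNNReal, Real.toNNReal_of_nonneg p.2.1]
  rfl

lemma bern_singleton_false (p : unitInterval) : bern p {false} = ENNReal.ofReal (1 - p) := by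
  classical
  rw [bern, bernoulliMeasure_apply _ (MeasurableSet.singleton _)]
  simp [ENNReal.ofReal, unitInterval.toNNReal,
    Real.toNNReal_of_nonneg (show (0 : ℝ) ≤ 1 - p from sub_nonneg.2 p.2.2)]
  rfl

lemma bern_absolutelyContinuous {p q : unitInterval} (hp0 : 0 < (p : ℝ)) (hp1 : (p : ℝ) < 1) :
    bern q ≪ bern p := by
  refine Measure.AbsolutelyContinuous.mk fun s _ hs => ?_
  suffices s = ∅ by simp [this]
  by_contra hne
  obtain ⟨b, hb⟩ := Set.nonempty_iff_ne_empty.2 hne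
  have h1 : bern p {b} = 0 := measure_mono_null (Set.singleton_subset_iff.2 hb) hs
  cases b
  · rw [bern_singleton_false, ENNReal.ofReal_eq_zero] at h1; linarith
  · rw [bern_singleton_true, ENNReal.ofReal_eq_zero] at h1; linarith

lemma rnDeriv_bern {p q : unitInterval} (hp0 : 0 < (p : ℝ)) (hp1 : (p : ℝ) < 1)
    (hq0 : 0 < (q : ℝ)) (hq1 : (q : ℝ) < 1) (b : Bool) :
    ((bern p).rnDeriv (bern q) b).toReal = if b = true then (p : ℝ) / q else (1 - p) / (1 - q) := by
  have h1 : bern p {b} = (bern p).rnDeriv (bern q) b * bern q {b} := by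
    conv_lhs => rw [← Measure.withDensity_rnDeriv_eq _ _
      (bern_absolutelyContinuous (p := q) (q := p) hq0 hq1)]
    rw [withDensity_apply _ (MeasurableSet.singleton _), lintegral_singleton]
  have h2 := congrArg ENNReal.toReal h1
  rw [ENNReal.toReal_mul] at h2
  cases b
  · rw [bern_singleton_false, bern_singleton_false, ENNReal.toReal_ofReal (by linarith),
      ENNReal.toReal_ofReal (by linarith)] at h2
    have : (1 : ℝ) - q ≠ 0 := by linarith
    simp only [Bool.false_eq_true, if_false]
    field_simp
    linarith
  · rw [bern_singleton_true, bern_singleton_true, ENNReal.toReal_ofReal hp0.le,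
      ENNReal.toReal_ofReal hq0.le] at h2
    simp only [if_true]
    field_simp
    linarith

/-- The density is `p/q`, in `[1, A]`, at an edge and `(1-p)/(1-q)`, in `[c, 1]`, at a non-edge. -/
lemma llrBoundedBy_bern {p q : unitInterval} {A c : ℝ} (hq : 0 < (q : ℝ)) (hqp : q ≤ p)
    (hA : (p : ℝ) ≤ A * q) (hc : 0 < c) (hpc : (p : ℝ) ≤ 1 - c) :
    LLRBoundedBy (bern p) (bern q) (max (Real.log A) (-Real.log c)) := by
  have hqp' : (q : ℝ) ≤ p := hqp
  have hp0 : 0 < (p : ℝ) := by linarith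
  have hp1 : (p : ℝ) < 1 := by linarith
  have hq1 : (q : ℝ) < 1 := by linarith
  refine ⟨bern_absolutelyContinuous hq hq1, bern_absolutelyContinuous hp0 hp1,
    ae_of_all _ fun b => ?_⟩
  rw [llr_def]
  simp only [rnDeriv_bern hp0 hp1 hq hq1]
  cases b
  · simp only [Bool.false_eq_true, if_false]
    refine le_trans ?_ (le_max_right _ _)
    have h1 : (1 - (p : ℝ)) / (1 - q) ≤ 1 := by rw [div_le_one (by linarith)]; linarith
    have h2 : c ≤ (1 - (p : ℝ)) / (1 - q) := by
      rw [le_div_iff₀ (by linarith)]; nlinarith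
    rw [abs_of_nonpos (Real.log_nonpos (by linarith) h1)]
    exact neg_le_neg (Real.log_le_log hc h2)
  · simp only [if_true]
    refine le_trans ?_ (le_max_left _ _)
    have h1 : 1 ≤ (p : ℝ) / q := by rwa [le_div_iff₀ hq, one_mul]
    rw [abs_of_nonneg (Real.log_nonneg h1)]
    exact Real.log_le_log (by linarith) (by rwa [div_le_iff₀ hq])

/-! ### Linear statistics of the log-likelihood ratios -/

/-- The indicator of the community of `x`. -/
noncomputable def nodeInd {n : ℕ} (x : Labels n) (i : Fin n) : ℝ := if x i = true then 1 else 0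

/-- The indicator of the pairs inside the community of `x`. -/
noncomputable def edgeInd {n : ℕ} (x : Labels n) (e : Pair n) : ℝ :=
  nodeInd x e.1.1 * nodeInd x e.1.2

variable {𝓨 : Type*} [MeasurableSpace 𝓨] {n M : ℕ}

/-- The law of the observation in the absence of a community. -/
noncomputable def nullLaw (n M : ℕ) (Q : Measure Bool) (U : Measure 𝓨) :
    Measure (GraphObs n × SideObs 𝓨 n M) :=
  (Measure.pi fun _ => Q).prod (Measure.pi fun _ => Measure.pi fun _ => U)

instance (Q : Measure Bool) (U : Measure 𝓨) [IsProbabilityMeasure Q] [IsProbabilityMeasure U] :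
    IsProbabilityMeasure (nullLaw n M Q U) := by
  unfold nullLaw; infer_instance

/-- The sum of the log-likelihood ratios of all observations, with weights `a e` for the edge
indicators and `b i` for the features of node `i`. -/
noncomputable def linStat (P Q : Measure Bool) (V U : Measure 𝓨) (a : Pair n → ℝ) (b : Fin n → ℝ)
    (z : GraphObs n × SideObs 𝓨 n M) : ℝ :=
  ∑ e, a e * llr P Q (z.1 e) + ∑ i, ∑ m, b i * llr V U (z.2 i m)

section

variable (P Q : Measure Bool) (V U : Measure 𝓨)

@[fun_prop]
lemma measurable_linStat (a : Pair n → ℝ) (b : Fin n → ℝ) :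
    Measurable (linStat (M := M) P Q V U a b) := by
  have h1 := measurable_llr P Q
  have h2 := measurable_llr V U
  unfold linStat
  fun_prop

lemma linStat_add (a a' : Pair n → ℝ) (b b' : Fin n → ℝ) (z : GraphObs n × SideObs 𝓨 n M) :
    linStat P Q V U (a + a') (b + b') z = linStat P Q V U a b z + linStat P Q V U a' b' z := by
  simp only [linStat, Pi.add_apply, add_mul, Finset.sum_add_distrib]
  ring

lemma linStat_smul (c : ℝ) (a : Pair n → ℝ) (b : Fin n → ℝ) (z : GraphObs n × SideObs 𝓨 n M) :
    linStat P Q V U (c • a) (c • b) z = c * linStat P Q V U a b z := by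
  simp only [linStat, Pi.smul_apply, smul_eq_mul, mul_assoc, mul_add, Finset.mul_sum]

lemma linStat_sub (a a' : Pair n → ℝ) (b b' : Fin n → ℝ) (z : GraphObs n × SideObs 𝓨 n M) :
    linStat P Q V U (a - a') (b - b') z = linStat P Q V U a b z - linStat P Q V U a' b' z := by
  simp only [linStat, Pi.sub_apply, sub_mul, Finset.sum_sub_distrib]
  ring

lemma ofReal_exp_linStat (a : Pair n → ℝ) (b : Fin n → ℝ) (z : GraphObs n × SideObs 𝓨 n M) :
    ENNReal.ofReal (Real.exp (linStat P Q V U a b z))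
      = (∏ e, ENNReal.ofReal (Real.exp (a e * llr P Q (z.1 e)))) *
        ∏ i, ∏ m, ENNReal.ofReal (Real.exp (b i * llr V U (z.2 i m))) := by
  rw [linStat, Real.exp_add, ENNReal.ofReal_mul (Real.exp_pos _).le, Real.exp_sum, Real.exp_sum,
    ENNReal.ofReal_prod_of_nonneg fun _ _ => (Real.exp_pos _).le,
    ENNReal.ofReal_prod_of_nonneg fun _ _ => (Real.exp_pos _).le]
  congr 1
  refine Finset.prod_congr rfl fun i _ => ?_
  rw [Real.exp_sum, ENNReal.ofReal_prod_of_nonneg fun _ _ => (Real.exp_pos _).le]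

variable [IsProbabilityMeasure Q] [IsProbabilityMeasure U]

lemma lintegral_exp_linStat (a : Pair n → ℝ) (b : Fin n → ℝ) :
    ∫⁻ z, ENNReal.ofReal (Real.exp (linStat P Q V U a b z)) ∂nullLaw n M Q U
      = (∏ e, expMoment P Q (a e)) * ∏ i, ∏ _m : Fin M, expMoment V U (b i) := by
  have h1 := measurable_llr P Q
  have h2 := measurable_llr V U
  simp only [ofReal_exp_linStat]
  rw [nullLaw, lintegral_prod_mul
    (f := fun G : GraphObs n => ∏ e, ENNReal.ofReal (Real.exp (a e * llr P Q (G e))))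
    (g := fun y : SideObs 𝓨 n M => ∏ i, ∏ m, ENNReal.ofReal (Real.exp (b i * llr V U (y i m))))
    (Measurable.aemeasurable (by fun_prop)) (Measurable.aemeasurable (by fun_prop))]
  congr 1
  · exact lintegral_pi_prod (fun _ : Pair n => Q)
      (φ := fun e v => ENNReal.ofReal (Real.exp (a e * llr P Q v))) (fun e => by fun_prop)
  · rw [lintegral_pi_prod (fun _ : Fin n => Measure.pi fun _ : Fin M => U)
      (φ := fun i w => ∏ m, ENNReal.ofReal (Real.exp (b i * llr V U (w m))))
      (fun e => by fun_prop)]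
    refine Finset.prod_congr rfl fun i _ => ?_
    exact lintegral_pi_prod (fun _ : Fin M => U)
      (φ := fun _ v => ENNReal.ofReal (Real.exp (b i * llr V U v))) (fun e => by fun_prop)

variable {P Q V U}

/-- By independence the moment factors over observations; factor bounds with exponents linear in `D`
and `E` then reduce to summing the weights `r` and `s`. -/
lemma lintegral_exp_linStat_le {a r : Pair n → ℝ} {b s : Fin n → ℝ} {D E : ℝ}
    (ha : ∀ e, expMoment P Q (a e) ≤ ENNReal.ofReal (Real.exp (r e * D)))
    (hb : ∀ i, expMoment V U (b i) ≤ ENNReal.ofReal (Real.exp (s i * E))) :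
    ∫⁻ z, ENNReal.ofReal (Real.exp (linStat P Q V U a b z)) ∂nullLaw n M Q U
      ≤ ENNReal.ofReal (Real.exp ((∑ e, r e) * D + M * (∑ i, s i) * E)) := by
  rw [lintegral_exp_linStat, Real.exp_add, ENNReal.ofReal_mul (Real.exp_pos _).le]
  gcongr ?_ * ?_
  · rw [Finset.sum_mul, Real.exp_sum,
      ENNReal.ofReal_prod_of_nonneg fun _ _ => (Real.exp_pos _).le]
    exact Finset.prod_le_prod' fun e _ => ha e
  · have : (M : ℝ) * (∑ i, s i) * E = ∑ i, ∑ _m : Fin M, s i * E := by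
      simp only [Finset.sum_const, Finset.card_univ, Fintype.card_fin, nsmul_eq_mul,
        Finset.mul_sum, Finset.sum_mul, mul_assoc]
    rw [this, Real.exp_sum, ENNReal.ofReal_prod_of_nonneg fun _ _ => (Real.exp_pos _).le]
    refine Finset.prod_le_prod' fun i _ => ?_
    rw [Real.exp_sum, ENNReal.ofReal_prod_of_nonneg fun _ _ => (Real.exp_pos _).le]
    exact Finset.prod_le_prod' fun m _ => hb i

end

/-! ### Likelihoods and change of measure -/

/-- The log-likelihood ratio of the observation between the labels `x` and no community. -/
noncomputable abbrev logLik (p q : unitInterval) (V U : Measure 𝓨) (x : Labels n)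
    (z : GraphObs n × SideObs 𝓨 n M) : ℝ :=
  linStat (bern p) (bern q) V U (edgeInd x) (nodeInd x) z

lemma obsKernel_eq_withDensity {p q : unitInterval} {V U : Measure 𝓨} [IsProbabilityMeasure V]
    [IsProbabilityMeasure U] {B B' : ℝ} (hPQ : LLRBoundedBy (bern p) (bern q) B)
    (hVU : LLRBoundedBy V U B') (x : Labels n) :
    obsKernel n M p q V U x = (nullLaw n M (bern q) U).withDensity
      fun z => ENNReal.ofReal (Real.exp (logLik p q V U x z)) := by
  have h1 := measurable_llr (bern p) (bern q)
  have h2 := measurable_llr V U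
  have i1 : ∀ e : Pair n, IsProbabilityMeasure
      (if x e.1.1 = true ∧ x e.1.2 = true then bern p else bern q) := by
    intro e; split_ifs <;> infer_instance
  have i2 : ∀ i : Fin n, IsProbabilityMeasure (if x i = true then V else U) := by
    intro i; split_ifs <;> infer_instance
  have e1 : graphLaw n p q x = (Measure.pi fun _ => bern q).withDensity fun G =>
      ∏ e, ENNReal.ofReal (Real.exp (edgeInd x e * llr (bern p) (bern q) (G e))) := by
    refine pi_eq_withDensity (fun _ => bern q) _
      (φ := fun e v => ENNReal.ofReal (Real.exp (edgeInd x e * llr (bern p) (bern q) v)))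
      (fun e => by fun_prop) fun e => ?_
    by_cases ha : x e.1.1 = true <;> by_cases hb : x e.1.2 = true <;>
      simp [edgeInd, nodeInd, ha, hb, hPQ.withDensity_exp_llr]
  have e2 : sideLaw n M V U x = (Measure.pi fun _ => Measure.pi fun _ => U).withDensity fun y =>
      ∏ i, ∏ m, ENNReal.ofReal (Real.exp (nodeInd x i * llr V U (y i m))) := by
    refine pi_eq_withDensity (fun _ => Measure.pi fun _ => U) _
      (φ := fun i w => ∏ m, ENNReal.ofReal (Real.exp (nodeInd x i * llr V U (w m))))
      (fun i => by fun_prop) fun i => ?_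
    refine pi_eq_withDensity (fun _ => U) _
      (φ := fun _ v => ENNReal.ofReal (Real.exp (nodeInd x i * llr V U v)))
      (fun e => by fun_prop) fun e => ?_
    by_cases ha : x i = true <;> simp [nodeInd, ha, hVU.withDensity_exp_llr]
  change (graphLaw n p q x).prod (sideLaw n M V U x) = _
  simp only [logLik, ofReal_exp_linStat]
  have i3 : IsProbabilityMeasure (graphLaw n p q x) := by unfold graphLaw; infer_instance
  have i4 : IsProbabilityMeasure (sideLaw n M V U x) := by unfold sideLaw; infer_instance
  rw [e1] at i3 ⊢
  rw [e2] at i4 ⊢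
  rw [prod_withDensity (by fun_prop) (by fun_prop), nullLaw]

lemma lintegral_obsKernel_exp {p q : unitInterval} {V U : Measure 𝓨} [IsProbabilityMeasure V]
    [IsProbabilityMeasure U] {B B' : ℝ} (hPQ : LLRBoundedBy (bern p) (bern q) B)
    (hVU : LLRBoundedBy V U B') (x : Labels n) {L : GraphObs n × SideObs 𝓨 n M → ℝ}
    (hL : Measurable L) :
    ∫⁻ z, ENNReal.ofReal (Real.exp (L z)) ∂obsKernel n M p q V U x
      = ∫⁻ z, ENNReal.ofReal (Real.exp (logLik p q V U x z + L z)) ∂nullLaw n M (bern q) U := by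
  rw [obsKernel_eq_withDensity hPQ hVU, lintegral_withDensity_eq_lintegral_mul _ (by fun_prop)
    (by fun_prop)]
  refine lintegral_congr fun z => ?_
  rw [Pi.mul_apply, Real.exp_add, ENNReal.ofReal_mul (Real.exp_pos _).le]

/-- Chernoff's bound. -/
lemma measure_ge_le_exp_mul_lintegral {Ω : Type*} [MeasurableSpace Ω] (μ : Measure Ω)
    {L : Ω → ℝ} (hL : Measurable L) (θ : ℝ) {s : ℝ} (hs : 0 ≤ s) :
    μ {z | θ ≤ L z}
      ≤ ENNReal.ofReal (Real.exp (-(s * θ))) * ∫⁻ z, ENNReal.ofReal (Real.exp (s * L z)) ∂μ := by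
  rw [← lintegral_const_mul _ (by fun_prop)]
  calc μ {z | θ ≤ L z} = ∫⁻ z in {z | θ ≤ L z}, 1 ∂μ := by simp
    _ ≤ ∫⁻ z in {z | θ ≤ L z}, ENNReal.ofReal (Real.exp (-(s * θ))) *
        ENNReal.ofReal (Real.exp (s * L z)) ∂μ := by
      refine setLIntegral_mono (by fun_prop) fun z hz => ?_
      rw [← ENNReal.ofReal_mul (Real.exp_pos _).le, ← Real.exp_add, ENNReal.one_le_ofReal,
        Real.one_le_exp_iff]
      have := mul_le_mul_of_nonneg_left (show θ ≤ L z from hz) hs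
      linarith
    _ ≤ _ := setLIntegral_le_lintegral _ _

/-! ### Counting pairs -/

lemma two_mul_sum_pair (u : Fin n → ℝ) :
    2 * ∑ e : Pair n, u e.1.1 * u e.1.2 = (∑ i, u i) ^ 2 - ∑ i, u i ^ 2 := by
  have h0 : ∑ e : Pair n, u e.1.1 * u e.1.2
      = ∑ i, ∑ j, if i < j then u i * u j else 0 := by
    rw [← Fintype.sum_prod_type' (f := fun i j => if i < j then u i * u j else 0),
      ← Finset.sum_filter]
    exact (Finset.sum_subtype (f := fun e : Fin n × Fin n => u e.1 * u e.2) _ (by simp)).symm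
  have h1 : ∑ i, ∑ j, (if i < j then u i * u j else 0)
      = ∑ i, ∑ j, if j < i then u i * u j else 0 := by
    rw [Finset.sum_comm]
    simp only [mul_comm]
  have h2 : ∑ i, u i ^ 2 = ∑ i, ∑ j, if i = j then u i * u j else 0 := by
    simp [sq]
  rw [h0, two_mul]
  nth_rw 2 [h1]
  rw [h2, sq, Finset.sum_mul_sum, eq_sub_iff_add_eq]
  simp only [← Finset.sum_add_distrib]
  refine Finset.sum_congr rfl fun i _ => Finset.sum_congr rfl fun j _ => ?_
  rcases lt_trichotomy i j with h | h | h
  · simp [h, h.ne, h.not_gt]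
  · simp [h]
  · simp [h, h.ne', h.not_gt]

/-- The number of members of the community of `x`. -/
def size (x : Labels n) : ℕ := (Finset.univ.filter fun i => x i = true).card

lemma sum_nodeInd (x : Labels n) : ∑ i, nodeInd x i = size x := by
  simp [nodeInd, size]

lemma sum_edgeInd (x : Labels n) : ∑ e, edgeInd x e = (size x : ℝ) * (size x - 1) / 2 := by
  have h := two_mul_sum_pair (nodeInd x)
  have h2 : ∑ i, nodeInd x i ^ 2 = ∑ i, nodeInd x i :=
    Finset.sum_congr rfl fun i _ => by unfold nodeInd; split_ifs <;> simp
  rw [h2, sum_nodeInd] at h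
  simp only [edgeInd]
  linarith

end SingleCommunity

namespace SingleCommunity

variable {𝓨 : Type*} [MeasurableSpace 𝓨] {n M : ℕ}

/-! ### Combinatorics of label vectors -/

/-- The labels of the common members of two communities. -/
def meet (x y : Labels n) : Labels n := fun i => x i && y i

lemma nodeInd_meet (x y : Labels n) (i : Fin n) :
    nodeInd (meet x y) i = nodeInd x i * nodeInd y i := by
  cases hx : x i <;> cases hy : y i <;> simp [nodeInd, meet, hx, hy]

lemma edgeInd_meet (x y : Labels n) (e : Pair n) :
    edgeInd (meet x y) e = edgeInd x e * edgeInd y e := by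
  simp only [edgeInd, nodeInd_meet]; ring

lemma nodeInd_eq_zero_or_one (x : Labels n) (i : Fin n) : nodeInd x i = 0 ∨ nodeInd x i = 1 := by
  unfold nodeInd; split_ifs <;> simp

lemma edgeInd_eq_zero_or_one (x : Labels n) (e : Pair n) : edgeInd x e = 0 ∨ edgeInd x e = 1 := by
  unfold edgeInd
  rcases nodeInd_eq_zero_or_one x e.1.1 with h | h <;>
    rcases nodeInd_eq_zero_or_one x e.1.2 with h' | h' <;> simp [h, h']

lemma meet_le (x y : Labels n) (i : Fin n) (h : meet x y i = true) : x i = true := by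
  simp only [meet, Bool.and_eq_true] at h; exact h.1

lemma nodeInd_mul_of_le {w x : Labels n} (h : ∀ i, w i = true → x i = true) (i : Fin n) :
    nodeInd w i = nodeInd x i * nodeInd w i := by
  cases hw : w i
  · simp [nodeInd, hw]
  · simp [nodeInd, hw, h i hw]

lemma edgeInd_mul_of_le {w x : Labels n} (h : ∀ i, w i = true → x i = true) (e : Pair n) :
    edgeInd w e = edgeInd x e * edgeInd w e := by
  have h1 := nodeInd_mul_of_le h e.1.1
  have h2 := nodeInd_mul_of_le h e.1.2
  unfold edgeInd
  rw [h1, h2]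
  rcases nodeInd_eq_zero_or_one x e.1.1 with h | h <;>
    rcases nodeInd_eq_zero_or_one x e.1.2 with h' | h' <;> simp [h, h']

lemma size_le_of_le {w x : Labels n} (h : ∀ i, w i = true → x i = true) : size w ≤ size x :=
  Finset.card_le_card fun i hi => by
    simp only [Finset.mem_filter, Finset.mem_univ, true_and] at hi ⊢; exact h i hi

lemma hammingDist_eq (x y : Labels n) :
    (hammingDist x y : ℝ) = size x + size y - 2 * size (meet x y) := by
  rw [← sum_nodeInd, ← sum_nodeInd, ← sum_nodeInd, hammingDist, Finset.card_filter, Nat.cast_sum,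
    Finset.mul_sum, ← Finset.sum_add_distrib, ← Finset.sum_sub_distrib]
  refine Finset.sum_congr rfl fun i _ => ?_
  rw [nodeInd_meet]
  cases hx : x i <;> cases hy : y i <;> norm_num [nodeInd, hx, hy]

lemma sum_prod_labels (f : Fin n → Bool → ℝ) :
    ∑ x : Labels n, ∏ i, f i (x i) = ∏ i, (f i true + f i false) := by
  have := Finset.prod_univ_sum (fun _ : Fin n => (Finset.univ : Finset Bool)) f
  simp only [Fintype.piFinset_univ, Fintype.sum_bool] at this
  exact this.symm

lemma one_add_pow_le_exp {s : ℝ} (hs : 0 ≤ s) (n : ℕ) : (1 + s) ^ n ≤ Real.exp (s * n) := by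
  rw [mul_comm, Real.exp_nat_mul]
  exact pow_le_pow_left₀ (by linarith) (by linarith [Real.add_one_le_exp s]) n

lemma prod_ite_size (x : Labels n) (a : ℝ) :
    ∏ i, (if x i = true then a else 1) = a ^ size x := by
  rw [Finset.prod_ite, Finset.prod_const, Finset.prod_const_one, mul_one, size]

lemma card_le_labels (x : Labels n) :
    ((Finset.univ.filter fun w : Labels n => ∀ i, w i = true → x i = true).card : ℝ)
      = 2 ^ size x := by
  classical
  have h : (Finset.univ.filter fun w : Labels n => ∀ i, w i = true → x i = true)
      = Fintype.piFinset fun i => if x i = true then Finset.univ else {false} := by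
    ext w
    simp only [Finset.mem_filter, Finset.mem_univ, true_and, Fintype.mem_piFinset]
    refine forall_congr' fun i => ?_
    cases hx : x i <;> cases hw : w i <;> simp
  rw [h, Fintype.card_piFinset, Nat.cast_prod, ← prod_ite_size]
  refine Finset.prod_congr rfl fun i _ => ?_
  cases hx : x i <;> simp

/-- The sum factors over nodes: a node of `x` contributes `2`, any other node `1 + exp(-Λ)`. For `Λ
= log(n/K)` and `size x = K` the bound is `2^K e^K`, so the entropy of the set `y \ x` is paid for
by `Λ` per node. -/
lemma sum_exp_neg_size_sub_le (x : Labels n) (Λ : ℝ) :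
    ∑ y : Labels n, Real.exp (-(Λ * (size y - size (meet x y))))
      ≤ 2 ^ size x * Real.exp (Real.exp (-Λ) * n) := by
  have hs := (Real.exp_pos (-Λ)).le
  have h : ∀ y : Labels n, Real.exp (-(Λ * (size y - size (meet x y))))
      = ∏ i, if x i = true then 1 else if y i = true then Real.exp (-Λ) else 1 := by
    intro y
    rw [← sum_nodeInd, ← sum_nodeInd, ← Finset.sum_sub_distrib, Finset.mul_sum,
      ← Finset.sum_neg_distrib, Real.exp_sum]
    refine Finset.prod_congr rfl fun i _ => ?_
    rw [nodeInd_meet]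
    cases hx : x i <;> cases hy : y i <;> simp [nodeInd, hx, hy]
  simp only [h]
  rw [sum_prod_labels fun i b => if x i = true then 1 else if b = true then Real.exp (-Λ) else 1]
  calc _ ≤ ∏ i, ((if x i = true then 2 else 1) * (1 + Real.exp (-Λ))) := by
        refine Finset.prod_le_prod (fun i _ => by split_ifs <;> positivity) fun i _ => ?_
        cases hx : x i
        · simp [add_comm]
        · norm_num; linarith
    _ = 2 ^ size x * (1 + Real.exp (-Λ)) ^ n := by
        rw [Finset.prod_mul_distrib, prod_ite_size]; simp
    _ ≤ _ := by gcongr; exact one_add_pow_le_exp hs n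

/-- The number of label vectors in a Hamming ball. -/
lemma card_hammingBall_le (y : Labels n) {Λ r : ℝ} (hΛ : 0 ≤ Λ) :
    ((Finset.univ.filter fun x : Labels n => (hammingDist y x : ℝ) ≤ r).card : ℝ)
      ≤ Real.exp (Λ * r + Real.exp (-Λ) * n) := by
  have hs := (Real.exp_pos (-Λ)).le
  -- Markov's inequality for the counting measure, applied to `exp(-Λ d)`, whose sum over the cube
  -- factors over coordinates.
  have h : ∀ x : Labels n, Real.exp (-(Λ * hammingDist y x))
      = ∏ i, if y i ≠ x i then Real.exp (-Λ) else 1 := by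
    intro x
    rw [Finset.prod_ite, Finset.prod_const, Finset.prod_const_one, mul_one, ← Real.exp_nat_mul,
      hammingDist]
    ring_nf
  have h2 : ∑ x : Labels n, Real.exp (-(Λ * hammingDist y x)) = (1 + Real.exp (-Λ)) ^ n := by
    simp only [h]
    rw [sum_prod_labels fun i b => if y i ≠ b then Real.exp (-Λ) else 1]
    rw [Finset.prod_congr rfl (g := fun _ => 1 + Real.exp (-Λ)), Finset.prod_const,
      Finset.card_univ, Fintype.card_fin]
    intro i _
    cases y i <;> simp [add_comm]
  have h3 : ((Finset.univ.filter fun x : Labels n => (hammingDist y x : ℝ) ≤ r).card : ℝ)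
      * Real.exp (-(Λ * r)) ≤ (1 + Real.exp (-Λ)) ^ n := by
    rw [← h2, ← nsmul_eq_mul]
    refine le_trans (Finset.card_nsmul_le_sum _ _ _ fun x hx => ?_)
      (Finset.sum_le_sum_of_subset_of_nonneg (Finset.filter_subset _ _)
        fun _ _ _ => (Real.exp_pos _).le)
    simp only [Finset.mem_filter, Finset.mem_univ, true_and] at hx
    gcongr
  have h4 := h3.trans (one_add_pow_le_exp hs n)
  rw [Real.exp_neg, ← div_eq_mul_inv, div_le_iff₀ (Real.exp_pos _), ← Real.exp_add] at h4
  rwa [add_comm]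

/-! ### Tail bounds for the log-likelihood ratios -/

section

variable {p q : unitInterval} {V U : Measure 𝓨} [IsProbabilityMeasure V]
  [IsProbabilityMeasure U] {B : ℝ}

/-- The expected increase of the log-likelihood when the community of `w` grows to that of `x`. -/
noncomputable def meanGain (M : ℕ) (p q : unitInterval) (V U : Measure 𝓨) (x w : Labels n) : ℝ :=
  (∑ e, edgeInd x e - ∑ e, edgeInd w e) * edgeKL p q + M * ((size x : ℝ) - size w) * featureKL V U

lemma LLRBoundedBy.expMoment_eq_one {Ω : Type*} [MeasurableSpace Ω] {P Q : Measure Ω}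
    [IsProbabilityMeasure P] [IsProbabilityMeasure Q] (h : LLRBoundedBy P Q B) {a : ℝ}
    (ha : a = 0 ∨ a = 1) : expMoment P Q a = 1 := by
  rcases ha with rfl | rfl
  · exact expMoment_zero
  · exact h.expMoment_one

/-- The weights `u` and `v` are the indicators of two nested sets. -/
lemma LLRBoundedBy.expMoment_lerp_le {Ω : Type*} [MeasurableSpace Ω] {P Q : Measure Ω}
    [IsProbabilityMeasure P] [IsProbabilityMeasure Q] (h : LLRBoundedBy P Q B) {u v t : ℝ}
    (hu : u = 0 ∨ u = 1) (hv : v = 0 ∨ v = 1) (huv : v = u * v) (ht : |t| ≤ 2) :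
    expMoment P Q (u + t * (v - u)) ≤ ENNReal.ofReal
      (Real.exp ((-t + cumulantConst B * t ^ 2) * (u - v) * (klDiv P Q).toReal)) := by
  rcases hu with rfl | rfl <;> rcases hv with rfl | rfl
  · simp
  · norm_num at huv
  · have := h.expMoment_le (t := -t) (by rwa [abs_neg])
    simpa using this
  · simp [h.expMoment_one]

/-- Chernoff's bound for the lower tail. After the change to the null law an observation has weight
`1` inside `w`, `1 - t` inside `x` but not `w`, and `0` elsewhere, so only the middle group
contributes. -/
lemma obsKernel_logLik_sub_le (hPQ : LLRBoundedBy (bern p) (bern q) B)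
    (hVU : LLRBoundedBy V U B) {x w : Labels n} (hw : ∀ i, w i = true → x i = true) (θ : ℝ) {t : ℝ}
    (ht0 : 0 ≤ t) (ht : t ≤ 2) :
    obsKernel n M p q V U x {z | logLik p q V U x z - logLik p q V U w z ≤ θ}
      ≤ ENNReal.ofReal (Real.exp (t * θ +
        (-t + cumulantConst B * t ^ 2) * meanGain M p q V U x w)) := by
  have h0 : {z : GraphObs n × SideObs 𝓨 n M | logLik p q V U x z - logLik p q V U w z ≤ θ}
      = {z | -θ ≤ logLik p q V U w z - logLik p q V U x z} := by
    ext z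
    change (_ : ℝ) ≤ _ ↔ (_ : ℝ) ≤ _
    constructor <;> intro h <;> linarith
  rw [h0]
  refine (measure_ge_le_exp_mul_lintegral _ (by fun_prop) _ ht0).trans ?_
  rw [Real.exp_add, ENNReal.ofReal_mul (Real.exp_pos _).le,
    lintegral_obsKernel_exp hPQ hVU x (by fun_prop), mul_neg, neg_neg]
  gcongr
  have h1 : ∀ z : GraphObs n × SideObs 𝓨 n M,
      logLik p q V U x z + t * (logLik p q V U w z - logLik p q V U x z)
      = linStat (bern p) (bern q) V U (edgeInd x + t • (edgeInd w - edgeInd x))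
        (nodeInd x + t • (nodeInd w - nodeInd x)) z := by
    intro z; rw [linStat_add, linStat_smul, linStat_sub]
  simp only [h1]
  refine (lintegral_exp_linStat_le (D := edgeKL p q) (E := featureKL V U)
    (r := fun e => (-t + cumulantConst B * t ^ 2) * (edgeInd x e - edgeInd w e))
    (s := fun i => (-t + cumulantConst B * t ^ 2) * (nodeInd x i - nodeInd w i))
    (fun e => ?_) (fun i => ?_)).trans (le_of_eq ?_)
  · exact hPQ.expMoment_lerp_le (edgeInd_eq_zero_or_one _ _) (edgeInd_eq_zero_or_one _ _)
      (edgeInd_mul_of_le hw e) (by rwa [abs_of_nonneg ht0])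
  · exact hVU.expMoment_lerp_le (nodeInd_eq_zero_or_one _ _) (nodeInd_eq_zero_or_one _ _)
      (nodeInd_mul_of_le hw i) (by rwa [abs_of_nonneg ht0])
  · rw [← Finset.mul_sum, ← Finset.mul_sum, Finset.sum_sub_distrib, Finset.sum_sub_distrib,
      sum_nodeInd, sum_nodeInd, meanGain]
    congr 2
    ring

/-- Given `x`, the observations belonging to `y` but not to `x` follow the null law, so the
likelihood ratio has mean one and Markov's inequality applies. In terms of weights, `x + y - xy` is
`0` or `1`, where the exponential moment is exactly `1`. -/
lemma obsKernel_le_logLik_sub (hPQ : LLRBoundedBy (bern p) (bern q) B)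
    (hVU : LLRBoundedBy V U B) (x y : Labels n) (θ : ℝ) :
    obsKernel n M p q V U x {z | θ ≤ logLik p q V U y z - logLik p q V U (meet x y) z}
      ≤ ENNReal.ofReal (Real.exp (-θ)) := by
  refine (measure_ge_le_exp_mul_lintegral _ (by fun_prop) _ zero_le_one).trans ?_
  rw [lintegral_obsKernel_exp hPQ hVU x (by fun_prop), one_mul]
  have h1 : ∀ z : GraphObs n × SideObs 𝓨 n M,
      logLik p q V U x z + 1 * (logLik p q V U y z - logLik p q V U (meet x y) z)
      = linStat (bern p) (bern q) V U (edgeInd x + (edgeInd y - edgeInd (meet x y)))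
        (nodeInd x + (nodeInd y - nodeInd (meet x y))) z := by
    intro z; rw [linStat_add, linStat_sub, one_mul]
  simp only [h1]
  refine (mul_le_mul_right (lintegral_exp_linStat_le (D := 0) (E := 0) (r := 0) (s := 0)
    (fun e => ?_) (fun i => ?_)) _).trans (le_of_eq (by simp))
  · rw [hPQ.expMoment_eq_one]
    · simp
    · rw [Pi.add_apply, Pi.sub_apply, edgeInd_meet]
      rcases edgeInd_eq_zero_or_one x e with h | h <;>
        rcases edgeInd_eq_zero_or_one y e with h' | h' <;> simp [h, h']
  · rw [hVU.expMoment_eq_one]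
    · simp
    · rw [Pi.add_apply, Pi.sub_apply, nodeInd_meet]
      rcases nodeInd_eq_zero_or_one x i with h | h <;>
        rcases nodeInd_eq_zero_or_one y i with h' | h' <;> simp [h, h']

lemma obsKernel_le_logLik (hPQ : LLRBoundedBy (bern p) (bern q) B)
    (hVU : LLRBoundedBy V U B) (x : Labels n) (θ : ℝ) {s : ℝ} (hs0 : 0 ≤ s) (hs : s ≤ 2) :
    obsKernel n M p q V U x {z | θ ≤ logLik p q V U x z}
      ≤ ENNReal.ofReal (Real.exp (-(s * θ) + (s + cumulantConst B * s ^ 2) *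
        ((∑ e, edgeInd x e) * edgeKL p q + M * size x * featureKL V U))) := by
  refine (measure_ge_le_exp_mul_lintegral _ (by fun_prop) _ hs0).trans ?_
  rw [Real.exp_add, ENNReal.ofReal_mul (Real.exp_pos _).le,
    lintegral_obsKernel_exp hPQ hVU x (by fun_prop)]
  gcongr
  have h1 : ∀ z : GraphObs n × SideObs 𝓨 n M,
      logLik p q V U x z + s * logLik p q V U x z
      = linStat (bern p) (bern q) V U (edgeInd x + s • edgeInd x)
        (nodeInd x + s • nodeInd x) z := by
    intro z; rw [linStat_add, linStat_smul]
  simp only [h1]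
  refine (lintegral_exp_linStat_le (D := edgeKL p q) (E := featureKL V U)
    (r := fun e => (s + cumulantConst B * s ^ 2) * edgeInd x e)
    (s := fun i => (s + cumulantConst B * s ^ 2) * nodeInd x i)
    (fun e => ?_) (fun i => ?_)).trans (le_of_eq ?_)
  -- With `v = 0` and `t = -s`, the weight `u + t (v - u)` is `(1 + s) u`.
  · simpa using! hPQ.expMoment_lerp_le (t := -s) (edgeInd_eq_zero_or_one x e)
      (Or.inl (rfl : (0 : ℝ) = 0)) (by simp) (by rwa [abs_neg, abs_of_nonneg hs0])
  · simpa using! hVU.expMoment_lerp_le (t := -s) (nodeInd_eq_zero_or_one x i)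
      (Or.inl (rfl : (0 : ℝ) = 0)) (by simp) (by rwa [abs_neg, abs_of_nonneg hs0])
  · rw [← Finset.mul_sum, ← Finset.mul_sum, sum_nodeInd]
    congr 2
    ring

end

end SingleCommunity

namespace SingleCommunity

variable {𝓨 : Type*} [MeasurableSpace 𝓨] {n M : ℕ}

/-! ### The joint law -/

/-- The label vectors whose community has exactly `K` members, as a finset. -/
def communityFinset (n K : ℕ) : Finset (Labels n) := Finset.univ.filter fun x => size x = K

@[simp] lemma mem_communityFinset {K : ℕ} {x : Labels n} :
    x ∈ communityFinset n K ↔ size x = K := by simp [communityFinset]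

lemma coe_communityFinset (n K : ℕ) : (communityFinset n K : Set (Labels n)) = communities n K := by
  ext x
  rw [Finset.mem_coe, mem_communityFinset]
  rfl

lemma card_communityFinset (n K : ℕ) : (communityFinset n K).card = n.choose K := by
  classical
  have h : (Finset.powersetCard K (Finset.univ : Finset (Fin n))).card = n.choose K := by simp
  rw [← h]
  refine Finset.card_bij' (fun x _ => Finset.univ.filter fun i => x i = true)
    (fun s _ i => decide (i ∈ s)) ?_ ?_ ?_ ?_
  · intro x hx
    simpa [size] using hx
  · intro s hs
    simpa [size] using hs
  · intro x _; funext i; simp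
  · intro s _; ext i; simp

lemma communityFinset_nonempty {K : ℕ} (h : K ≤ n) : (communityFinset n K).Nonempty := by
  rw [← Finset.card_pos, card_communityFinset]
  exact Nat.choose_pos h

lemma jointLaw_apply (n K M : ℕ) (p q : unitInterval) (V U : Measure 𝓨)
    [IsProbabilityMeasure V] [IsProbabilityMeasure U]
    {s : Set (Labels n × (GraphObs n × SideObs 𝓨 n M))} (hs : MeasurableSet s) :
    jointLaw n K M p q V U s = ((communityFinset n K).card : ℝ≥0∞)⁻¹ *
      ∑ x ∈ communityFinset n K, obsKernel n M p q V U x (Prod.mk x ⁻¹' s) := by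
  rw [jointLaw, ← coe_communityFinset]
  have : SFinite (uniformOn (communityFinset n K : Set (Labels n))) := by
    unfold uniformOn; infer_instance
  rw [Measure.compProd_apply hs, uniformOn, ProbabilityTheory.cond, lintegral_smul_measure,
    Measure.count_apply_finset, smul_eq_mul]
  congr 1
  rw [lintegral_finset, Finset.sum_congr rfl]
  intro x _
  rw [Measure.count_singleton, mul_one]

lemma measurableSet_error {K : ℕ} {xhat : GraphObs n × SideObs 𝓨 n M → Labels n}
    (h : Measurable xhat) (ε : ℝ) :
    MeasurableSet {z : Labels n × (GraphObs n × SideObs 𝓨 n M) |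
      ε < (hammingDist (xhat z.2) z.1 : ℝ) / (K : ℝ)} := by
  have h1 : Measurable fun z : Labels n × (GraphObs n × SideObs 𝓨 n M) => (xhat z.2, z.1) := by
    fun_prop
  exact h1 (MeasurableSet.of_discrete
    (s := {w : Labels n × Labels n | ε < (hammingDist w.1 w.2 : ℝ) / (K : ℝ)}))

lemma jointLaw_error_le {K : ℕ} (hK : K ≤ n) (p q : unitInterval) (V U : Measure 𝓨)
    [IsProbabilityMeasure V] [IsProbabilityMeasure U]
    {xhat : GraphObs n × SideObs 𝓨 n M → Labels n} (h : Measurable xhat) (ε : ℝ) {δ : ℝ≥0∞}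
    (hδ : ∀ x : Labels n, size x = K →
      obsKernel n M p q V U x {z | ε < (hammingDist (xhat z) x : ℝ) / (K : ℝ)} ≤ δ) :
    jointLaw n K M p q V U {z | ε < (hammingDist (xhat z.2) z.1 : ℝ) / (K : ℝ)} ≤ δ := by
  rw [jointLaw_apply n K M p q V U (measurableSet_error h ε)]
  have hc : ((communityFinset n K).card : ℝ≥0∞) ≠ 0 := by
    simpa using (communityFinset_nonempty hK).ne_empty
  calc _ ≤ ((communityFinset n K).card : ℝ≥0∞)⁻¹ * ∑ x ∈ communityFinset n K, δ := by
        gcongr with x hx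
        exact hδ x (mem_communityFinset.1 hx)
    _ = δ := by
        rw [Finset.sum_const, nsmul_eq_mul, ← mul_assoc, ENNReal.inv_mul_cancel hc
          (ENNReal.natCast_ne_top _), one_mul]

/-! ### The maximum likelihood estimator -/

/-- The maximizer of `score` that is computed from the comparisons of the scores. -/
lemma exists_measurable_argmax {Ω : Type*} [MeasurableSpace Ω] {K : ℕ} (hK : K ≤ n)
    (score : Labels n → Ω → ℝ) (hs : ∀ x, Measurable (score x)) :
    ∃ xhat : Ω → Labels n, Measurable xhat ∧
      ∀ z, size (xhat z) = K ∧ ∀ x, size x = K → score x z ≤ score (xhat z) z := by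
  classical
  let pat : Ω → Labels n → Labels n → Prop := fun z x y => score x z ≤ score y z
  have hpat : Measurable pat := by
    refine measurable_pi_iff.2 fun x => measurable_pi_iff.2 fun y => ?_
    exact measurableSet_setOfPred.1 (measurableSet_le (hs x) (hs y))
  -- Choosing as a function of the finite comparison pattern alone makes measurability automatic.
  -- The default value is never used, since a maximizer exists.
  let pick : (Labels n → Labels n → Prop) → Labels n := fun c =>
    if h : ∃ y, size y = K ∧ ∀ x, size x = K → c x y then h.choose else fun _ => false
  have hpick : Measurable pick := .of_discrete
  refine ⟨fun z => pick (pat z), hpick.comp hpat, fun z => ?_⟩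
  have h : ∃ y, size y = K ∧ ∀ x, size x = K → pat z x y := by
    obtain ⟨y, hy, hmax⟩ := (communityFinset n K).exists_max_image (fun x => score x z)
      (communityFinset_nonempty hK)
    exact ⟨y, mem_communityFinset.1 hy, fun x hx => hmax x (mem_communityFinset.2 hx)⟩
  have h' : pick (pat z) = h.choose := dif_pos h
  simp only [h']
  exact h.choose_spec

section

variable {p q : unitInterval} {V U : Measure 𝓨} {B : ℝ}

lemma edgeKL_nonneg : 0 ≤ edgeKL p q := ENNReal.toReal_nonneg

lemma featureKL_nonneg : 0 ≤ featureKL V U := ENNReal.toReal_nonneg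

/-- Removing `l` of `K` members destroys `l(2K - l - 1)/2 ≥ l(K-1)/2` pairs but all `lM` features;
this is why the features count twice in the threshold. -/
lemma le_meanGain {x w : Labels n} (hw : ∀ i, w i = true → x i = true) :
    ((size x : ℝ) - size w) / 2 *
      (((size x : ℝ) - 1) * edgeKL p q + 2 * M * featureKL V U) ≤ meanGain M p q V U x w := by
  have h1 : (size w : ℝ) ≤ size x := by exact_mod_cast size_le_of_le hw
  have hD : 0 ≤ edgeKL p q := edgeKL_nonneg
  have h2 : 0 ≤ (size w : ℝ) * (size x - size w) * edgeKL p q := by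
    have : 0 ≤ (size x : ℝ) - size w := by linarith
    positivity
  rw [meanGain, sum_edgeInd, sum_edgeInd]
  nlinarith

variable [IsProbabilityMeasure V] [IsProbabilityMeasure U]

/-- The error probability of the maximum likelihood estimator. -/
lemma obsKernel_error_le (hPQ : LLRBoundedBy (bern p) (bern q) B)
    (hVU : LLRBoundedBy V U B) {xhat : GraphObs n × SideObs 𝓨 n M → Labels n} {x : Labels n}
    (hsize : ∀ z, size (xhat z) = size x)
    (hmax : ∀ z, logLik p q V U x z ≤ logLik p q V U (xhat z) z)
    (hx : 0 < size x) {ε η δ Λ : ℝ} (hε : 0 < ε) (hη0 : 0 ≤ η) (hη1 : η ≤ 1) (hδ : 0 ≤ δ)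
    (hΛ0 : 0 ≤ Λ) (hΛ : Real.exp (-Λ) * n ≤ size x)
    (hR : (1 + δ) * Λ ≤
      (1 - η) / 2 * (((size x : ℝ) - 1) * edgeKL p q + 2 * M * featureKL V U)) :
    obsKernel n M p q V U x {z | ε < (hammingDist (xhat z) x : ℝ) / (size x : ℝ)}
      ≤ ENNReal.ofReal (2 ^ size x * Real.exp (-(η ^ 2 / (4 * cumulantConst B) *
          (ε * size x / 4 * (((size x : ℝ) - 1) * edgeKL p q + M * featureKL V U)))) +
        2 ^ size x * Real.exp (size x) * Real.exp (-(δ * Λ * (ε * size x / 2)))) := by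
  classical
  have hB := hPQ.nonneg
  have hC := one_le_cumulantConst hB
  have hK : (0 : ℝ) < size x := by exact_mod_cast hx
  have hK1 : (1 : ℝ) ≤ size x := by exact_mod_cast hx
  have hD : 0 ≤ edgeKL p q := edgeKL_nonneg
  have hE : 0 ≤ featureKL V U := featureKL_nonneg
  set C := cumulantConst B with hCdef
  set T := ((size x : ℝ) - 1) * edgeKL p q + M * featureKL V U with hT
  set R := ((size x : ℝ) - 1) * edgeKL p q + 2 * M * featureKL V U with hRdef
  have hT0 : 0 ≤ T := by
    have : 0 ≤ (size x : ℝ) - 1 := by linarith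
    positivity
  have hRT : T ≤ R := by
    have : 0 ≤ M * featureKL V U := by positivity
    rw [hT, hRdef]; linarith
  set W := Finset.univ.filter fun w : Labels n =>
    (∀ i, w i = true → x i = true) ∧ ε * size x / 2 ≤ (size x : ℝ) - size w with hW
  set Y := Finset.univ.filter fun y : Labels n =>
    size y = size x ∧ ε * size x / 2 ≤ (size x : ℝ) - size (meet x y) with hY
  -- Sizes being equal, the Hamming error is twice the number of missed members. As the estimate
  -- scores at least as high as `x`, either `x` gains little over the common part or the estimate
  -- gains much; the first event depends on the common part alone.
  have hsub : {z : GraphObs n × SideObs 𝓨 n M |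
        ε < (hammingDist (xhat z) x : ℝ) / (size x : ℝ)} ⊆
      (⋃ w ∈ W, {z | logLik p q V U x z - logLik p q V U w z
        ≤ (1 - η) * meanGain M p q V U x w}) ∪
      ⋃ y ∈ Y, {z | (1 - η) * meanGain M p q V U x (meet x y)
        ≤ logLik p q V U y z - logLik p q V U (meet x y) z} := by
    intro z hz
    change ε < (hammingDist (xhat z) x : ℝ) / (size x : ℝ) at hz
    rw [lt_div_iff₀ hK, hammingDist_comm, hammingDist_eq, hsize] at hz
    have hl : ε * size x / 2 ≤ (size x : ℝ) - size (meet x (xhat z)) := by linarith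
    rcases le_total (logLik p q V U x z - logLik p q V U (meet x (xhat z)) z)
      ((1 - η) * meanGain M p q V U x (meet x (xhat z))) with h | h
    · left
      exact Set.mem_biUnion (show meet x (xhat z) ∈ W by
        simp only [hW, Finset.mem_filter, Finset.mem_univ, true_and]
        exact ⟨meet_le x _, hl⟩) h
    · right
      refine Set.mem_biUnion (show xhat z ∈ Y by
        simp only [hY, Finset.mem_filter, Finset.mem_univ, true_and]
        exact ⟨hsize z, hl⟩) ?_
      exact h.trans (sub_le_sub_right (hmax z) _)
  have h1 : obsKernel n M p q V U x (⋃ w ∈ W, {z | logLik p q V U x z - logLik p q V U w z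
        ≤ (1 - η) * meanGain M p q V U x w})
      ≤ ENNReal.ofReal (2 ^ size x * Real.exp (-(η ^ 2 / (4 * C) * (ε * size x / 4 * T)))) := by
    refine (measure_biUnion_finset_le _ _).trans ?_
    have hb : ∀ w ∈ W, obsKernel n M p q V U x {z | logLik p q V U x z - logLik p q V U w z
        ≤ (1 - η) * meanGain M p q V U x w}
        ≤ ENNReal.ofReal (Real.exp (-(η ^ 2 / (4 * C) * (ε * size x / 4 * T)))) := by
      intro w hw
      simp only [hW, Finset.mem_filter, Finset.mem_univ, true_and] at hw
      -- This `t` minimizes `-η t + C t²`, with value `-η²/(4C)`.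
      refine (obsKernel_logLik_sub_le hPQ hVU hw.1 _ (t := η / (2 * C)) (by positivity)
        (by rw [div_le_iff₀ (by positivity)]; nlinarith)).trans ?_
      gcongr
      have hm : ε * size x / 4 * T ≤ meanGain M p q V U x w := by
        refine le_trans ?_ (le_meanGain hw.1)
        have : ε * size x / 4 * T ≤ ε * size x / 4 * R := by gcongr
        have h3 : ε * size x / 2 / 2 * R ≤ ((size x : ℝ) - size w) / 2 * R := by
          have : 0 ≤ R := hT0.trans hRT
          gcongr
          exact hw.2
        linarith
      have h4 : η ^ 2 / (4 * C) * (ε * size x / 4 * T)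
          ≤ η ^ 2 / (4 * C) * meanGain M p q V U x w := by gcongr
      have h5 : η / (2 * C) * ((1 - η) * meanGain M p q V U x w) +
          (-(η / (2 * C)) + C * (η / (2 * C)) ^ 2) * meanGain M p q V U x w
          = -(η ^ 2 / (4 * C) * meanGain M p q V U x w) := by
        field_simp; ring
      rw [h5]
      linarith
    refine (Finset.sum_le_card_nsmul _ _ _ hb).trans ?_
    rw [nsmul_eq_mul, ← ENNReal.ofReal_natCast, ← ENNReal.ofReal_mul (by positivity)]
    gcongr
    rw [← card_le_labels]
    exact_mod_cast Finset.card_le_card fun w hw => by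
      simp only [hW, Finset.mem_filter, Finset.mem_univ, true_and] at hw ⊢; exact hw.1
  have h2 : obsKernel n M p q V U x (⋃ y ∈ Y, {z | (1 - η) * meanGain M p q V U x (meet x y)
        ≤ logLik p q V U y z - logLik p q V U (meet x y) z})
      ≤ ENNReal.ofReal (2 ^ size x * Real.exp (size x) *
        Real.exp (-(δ * Λ * (ε * size x / 2)))) := by
    refine (measure_biUnion_finset_le _ _).trans ?_
    have hb : ∀ y ∈ Y, obsKernel n M p q V U x {z | (1 - η) * meanGain M p q V U x (meet x y)
        ≤ logLik p q V U y z - logLik p q V U (meet x y) z}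
        ≤ ENNReal.ofReal (Real.exp (-(Λ * (size y - size (meet x y)))) *
          Real.exp (-(δ * Λ * (ε * size x / 2)))) := by
      -- With `l` missed members the level is at least `(1 + δ) Λ l`: the part `Λ l` pays for the
      -- sum over `y`, and `δ Λ l`, with `l ≥ εK/2`, is left over.
      intro y hy
      simp only [hY, Finset.mem_filter, Finset.mem_univ, true_and] at hy
      refine (obsKernel_le_logLik_sub hPQ hVU x y _).trans ?_
      rw [← Real.exp_add]
      gcongr
      rw [hy.1]
      set l := (size x : ℝ) - size (meet x y) with hl
      have hl0 : 0 ≤ l := le_trans (by positivity) hy.2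
      have h3 : l / 2 * R ≤ meanGain M p q V U x (meet x y) := le_meanGain (meet_le x y)
      have h4 : (1 - η) * (l / 2 * R) ≤ (1 - η) * meanGain M p q V U x (meet x y) := by
        gcongr
      have h5 : l * ((1 + δ) * Λ) ≤ l * ((1 - η) / 2 * R) := by gcongr
      have h6 : δ * Λ * (ε * size x / 2) ≤ δ * Λ * l := by gcongr; exact hy.2
      nlinarith
    refine (Finset.sum_le_sum hb).trans ?_
    rw [← ENNReal.ofReal_sum_of_nonneg fun _ _ => by positivity, ← Finset.sum_mul]
    gcongr
    refine (Finset.sum_le_sum_of_subset_of_nonneg (Finset.subset_univ _)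
      fun _ _ _ => (Real.exp_pos _).le).trans ((sum_exp_neg_size_sub_le x Λ).trans ?_)
    gcongr
  refine (measure_mono hsub).trans ((measure_union_le _ _).trans ((add_le_add h1 h2).trans ?_))
  rw [ENNReal.ofReal_add (by positivity) (by positivity)]

end

end SingleCommunity

/-! ### Converse by change of measure and volume of Hamming balls -/

namespace SingleCommunity

variable {𝓨 : Type*} [MeasurableSpace 𝓨] {n M : ℕ}

/-- Induction with `C(n+1, k+1) = C(n, k) (n+1)/(k+1)` and `(n+1)/(k+1) ≤ n/k`. -/
lemma div_pow_le_choose {n k : ℕ} (h : k ≤ n) : ((n : ℝ) / k) ^ k ≤ n.choose k := by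
  induction n generalizing k with
  | zero => obtain rfl : k = 0 := by omega
            simp
  | succ n ih =>
    rcases k with _ | k
    · simp
    have hk : k ≤ n := by omega
    have h1 : ((n + 1 : ℕ) : ℝ) * n.choose k = (n + 1).choose (k + 1) * (k + 1 : ℕ) := by
      exact_mod_cast Nat.add_one_mul_choose_eq n k
    have h2 : (((n + 1 : ℕ) : ℝ) / (k + 1 : ℕ)) ^ k ≤ n.choose k := by
      rcases Nat.eq_zero_or_pos k with rfl | hpos
      · simp
      refine le_trans (pow_le_pow_left₀ (by positivity) ?_ k) (ih hk)
      have hk' : (0 : ℝ) < k := by exact_mod_cast hpos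
      rw [div_le_div_iff₀ (by positivity) hk']
      have : (k : ℝ) ≤ n := by exact_mod_cast hk
      push_cast
      nlinarith
    rw [pow_succ]
    have h3 : ((n + 1).choose (k + 1) : ℝ)
        = n.choose k * (((n + 1 : ℕ) : ℝ) / (k + 1 : ℕ)) := by
      have : ((k + 1 : ℕ) : ℝ) ≠ 0 := by positivity
      field_simp
      linarith
    rw [h3]
    gcongr

/-- If at most `r` of the events `A i`, `i ∈ S`, happen outside of `bad`, then the sum of their
probabilities is at most `r + |S| P(bad)`. -/
lemma sum_measureReal_le {Ω ι : Type*} [MeasurableSpace Ω] (μ : Measure Ω) [IsProbabilityMeasure μ]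
    (S : Finset ι) {A : ι → Set Ω} (hA : ∀ i, MeasurableSet (A i)) {bad : Set Ω}
    (hbad : MeasurableSet bad) {r : ℝ} (hr : 0 ≤ r)
    (h : ∀ z ∉ bad, ∑ i ∈ S, (A i).indicator (fun _ => (1 : ℝ)) z ≤ r) :
    ∑ i ∈ S, μ.real (A i) ≤ r + S.card * μ.real bad := by
  have hi : ∀ s : Set Ω, MeasurableSet s → Integrable (s.indicator fun _ => (1 : ℝ)) μ :=
    fun s hs => (integrable_const _).indicator hs
  have h1 : ∫ z, ∑ i ∈ S, (A i).indicator (fun _ => (1 : ℝ)) z ∂μ = ∑ i ∈ S, μ.real (A i) := by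
    rw [integral_finsetSum _ fun i _ => hi _ (hA i)]
    refine Finset.sum_congr rfl fun i _ => ?_
    rw [integral_indicator_const _ (hA i), smul_eq_mul, mul_one]
  have h2 : ∫ z, (r + S.card * bad.indicator (fun _ => (1 : ℝ)) z) ∂μ
      = r + S.card * μ.real bad := by
    rw [integral_add (integrable_const _) ((hi _ hbad).const_mul _), integral_const_mul,
      integral_indicator_const _ hbad]
    simp
  rw [← h1, ← h2]
  refine integral_mono (integrable_finsetSum _ fun i _ => hi _ (hA i))
    ((integrable_const _).add ((hi _ hbad).const_mul _)) fun z => ?_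
  by_cases hz : z ∈ bad
  · simp only [Set.indicator_of_mem hz, mul_one]
    refine (Finset.sum_le_card_nsmul S _ 1 fun i _ => ?_).trans (by simp [hr])
    exact Set.indicator_le_self' (fun _ _ => zero_le_one) z
  · simpa [Set.indicator_of_notMem hz] using h z hz

lemma card_mul_jointLaw_real {K : ℕ} (hK : K ≤ n) (p q : unitInterval) (V U : Measure 𝓨)
    [IsProbabilityMeasure V] [IsProbabilityMeasure U]
    {s : Set (Labels n × (GraphObs n × SideObs 𝓨 n M))} (hs : MeasurableSet s) :
    ((communityFinset n K).card : ℝ) * (jointLaw n K M p q V U).real s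
      = ∑ x ∈ communityFinset n K, (obsKernel n M p q V U x).real (Prod.mk x ⁻¹' s) := by
  have hc : ((communityFinset n K).card : ℝ) ≠ 0 := by
    simpa using (communityFinset_nonempty hK).ne_empty
  rw [Measure.real, jointLaw_apply n K M p q V U hs, ENNReal.toReal_mul, ENNReal.toReal_inv,
    ENNReal.toReal_natCast, ← mul_assoc, mul_inv_cancel₀ hc, one_mul,
    ENNReal.toReal_sum fun x _ => measure_ne_top _ _]
  rfl

section

variable {p q : unitInterval} {V U : Measure 𝓨} [IsProbabilityMeasure V]
  [IsProbabilityMeasure U] {B : ℝ}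

/-- Change of measure from the law given `x` to the law in the absence of a community. -/
lemma obsKernel_real_inter_le (hPQ : LLRBoundedBy (bern p) (bern q) B)
    (hVU : LLRBoundedBy V U B) (x : Labels n) (θ : ℝ) {A : Set (GraphObs n × SideObs 𝓨 n M)}
    (hA : MeasurableSet A) :
    (obsKernel n M p q V U x).real (A ∩ {z | logLik p q V U x z ≤ θ})
      ≤ Real.exp θ * (nullLaw n M (bern q) U).real A := by
  have hm : MeasurableSet {z : GraphObs n × SideObs 𝓨 n M | logLik p q V U x z ≤ θ} :=
    measurableSet_le (by fun_prop) (by fun_prop)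
  rw [Measure.real, Measure.real, ← ENNReal.toReal_ofReal (Real.exp_pos θ).le,
    ← ENNReal.toReal_mul]
  refine ENNReal.toReal_mono (ENNReal.mul_ne_top ENNReal.ofReal_ne_top (measure_ne_top _ _)) ?_
  rw [obsKernel_eq_withDensity hPQ hVU, withDensity_apply _ (hA.inter hm),
    ← setLIntegral_const]
  refine (setLIntegral_mono measurable_const fun z hz => ?_).trans
    (lintegral_mono_set Set.inter_subset_left)
  have : logLik p q V U x z ≤ θ := hz.2
  gcongr

/-- Fano-type bound: an estimator with a small error needs a large mean log-likelihood ratio. -/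
lemma one_le_error_add {K : ℕ} (hK0 : 0 < K) (hKn : K ≤ n)
    (hPQ : LLRBoundedBy (bern p) (bern q) B) (hVU : LLRBoundedBy V U B)
    {xhat : GraphObs n × SideObs 𝓨 n M → Labels n} (hx : Measurable xhat) (ε θ : ℝ) {s : ℝ} (hs0 : 0 ≤ s) (hs : s ≤ 2) :
    1 ≤ (jointLaw n K M p q V U).real {z | ε < (hammingDist (xhat z.2) z.1 : ℝ) / (K : ℝ)} +
      Real.exp (-(s * θ) + (s + cumulantConst B * s ^ 2) *
        (K / 2 * (((K : ℝ) - 1) * edgeKL p q + 2 * M * featureKL V U))) +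
      Real.exp (θ + ε * K * Real.log (n / K) + K - K * Real.log (n / K)) := by
  classical
  set N : ℝ := ((communityFinset n K).card : ℝ) with hN
  set bnd := Real.exp (-(s * θ) + (s + cumulantConst B * s ^ 2) *
        (K / 2 * (((K : ℝ) - 1) * edgeKL p q + 2 * M * featureKL V U))) with hbnd
  set Λ := Real.log (n / K) with hΛ
  have hKr : (0 : ℝ) < K := by exact_mod_cast hK0
  have hnr : (K : ℝ) ≤ n := by exact_mod_cast hKn
  have hΛ0 : 0 ≤ Λ := Real.log_nonneg (by rwa [le_div_iff₀ hKr, one_mul])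
  have hratio : (0 : ℝ) < n / K := by have : (0 : ℝ) < n := by linarith
                                      positivity
  -- This identity turns the volume bound for the ball of radius `εK` into `exp(ΛεK + K)`.
  have hexp : Real.exp (-Λ) * n = K := by
    have : (n : ℝ) ≠ 0 := by linarith
    rw [Real.exp_neg, hΛ, Real.exp_log hratio]; field_simp
  have hNexp : Real.exp (K * Λ) ≤ N := by
    rw [hN, card_communityFinset, Real.exp_nat_mul, hΛ, Real.exp_log hratio]
    exact div_pow_le_choose hKn
  have hN0 : 0 < N := (Real.exp_pos _).trans_le hNexp
  let A : Labels n → Set (GraphObs n × SideObs 𝓨 n M) :=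
    fun x => {z | (hammingDist (xhat z) x : ℝ) ≤ ε * K}
  have hA : ∀ x, MeasurableSet (A x) := fun x =>
    hx (MeasurableSet.of_discrete (s := {w | (hammingDist w x : ℝ) ≤ ε * K}))
  have hpt : ∀ x ∈ communityFinset n K, 1 ≤ (obsKernel n M p q V U x).real
      (Prod.mk x ⁻¹' {z | ε < (hammingDist (xhat z.2) z.1 : ℝ) / (K : ℝ)}) + bnd +
      Real.exp θ * (nullLaw n M (bern q) U).real (A x) := by
    intro x hxK
    have hxs : size x = K := mem_communityFinset.1 hxK
    have h1 : (obsKernel n M p q V U x).real {z | θ ≤ logLik p q V U x z} ≤ bnd := by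
      refine ENNReal.toReal_le_of_le_ofReal (Real.exp_pos _).le
        ((obsKernel_le_logLik hPQ hVU x θ hs0 hs).trans (le_of_eq ?_))
      rw [sum_edgeInd, hxs]
      congr 2
      ring
    have h2 := obsKernel_real_inter_le hPQ hVU x θ (hA x)
    -- Either the estimate is bad, or the log-likelihood is atypically large, or the estimate is
    -- good and the change of measure costs at most `exp θ`.
    have h3 : (Set.univ : Set (GraphObs n × SideObs 𝓨 n M)) ⊆
        (Prod.mk x ⁻¹' {z | ε < (hammingDist (xhat z.2) z.1 : ℝ) / (K : ℝ)} ∪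
          {z | θ ≤ logLik p q V U x z}) ∪ (A x ∩ {z | logLik p q V U x z ≤ θ}) := by
      intro z _
      by_cases hz : ε < (hammingDist (xhat z) x : ℝ) / (K : ℝ)
      · exact Or.inl (Or.inl hz)
      · rcases le_total θ (logLik p q V U x z) with h | h
        · exact Or.inl (Or.inr h)
        · refine Or.inr ⟨?_, h⟩
          rw [not_lt, div_le_iff₀ hKr] at hz
          exact hz
    have h4 := measureReal_mono (μ := obsKernel n M p q V U x) h3
    rw [probReal_univ] at h4
    have h5 := h4.trans (measureReal_union_le _ _)
    have h6 := measureReal_union_le (μ := obsKernel n M p q V U x)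
      (Prod.mk x ⁻¹' {z | ε < (hammingDist (xhat z.2) z.1 : ℝ) / (K : ℝ)})
      {z | θ ≤ logLik p q V U x z}
    linarith
  have hsum := Finset.sum_le_sum hpt
  rw [Finset.sum_add_distrib, Finset.sum_add_distrib, ← Finset.mul_sum,
    ← card_mul_jointLaw_real hKn p q V U (measurableSet_error hx ε)] at hsum
  simp only [Finset.sum_const, nsmul_eq_mul, mul_one, ← hN] at hsum
  have hball : ∑ x ∈ communityFinset n K, (nullLaw n M (bern q) U).real (A x)
      ≤ Real.exp (Λ * (ε * K) + K) := by
    -- The null law does not depend on `x`, so for each fixed observation only the label vectors in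
    -- one Hamming ball around the estimate count; no exceptional event is needed.
    have := sum_measureReal_le (nullLaw n M (bern q) U) (communityFinset n K) hA
      (bad := ∅) MeasurableSet.empty (r := Real.exp (Λ * (ε * K) + K)) (Real.exp_pos _).le
      fun z _ => ?_
    · simpa using this
    · have hb := card_hammingBall_le (xhat z) (Λ := Λ) (r := ε * K) hΛ0
      rw [hexp] at hb
      refine le_trans ?_ hb
      refine (Finset.sum_le_sum_of_subset_of_nonneg (Finset.subset_univ _)
        fun _ _ _ => Set.indicator_nonneg (fun _ _ => zero_le_one) _).trans (le_of_eq ?_)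
      rw [Finset.card_filter, Nat.cast_sum]
      refine Finset.sum_congr rfl fun x _ => ?_
      simp only [Set.indicator_apply, Nat.cast_ite, Nat.cast_one, Nat.cast_zero]
      rfl
  have hlast : Real.exp θ * Real.exp (Λ * (ε * K) + K)
      ≤ N * Real.exp (θ + ε * K * Λ + K - K * Λ) := by
    calc Real.exp θ * Real.exp (Λ * (ε * K) + K)
        = Real.exp (K * Λ) * Real.exp (θ + ε * K * Λ + K - K * Λ) := by
          rw [← Real.exp_add, ← Real.exp_add]; ring_nf
      _ ≤ _ := by gcongr
  have h7 : Real.exp θ * ∑ x ∈ communityFinset n K, (nullLaw n M (bern q) U).real (A x)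
      ≤ Real.exp θ * Real.exp (Λ * (ε * K) + K) := by gcongr
  refine le_of_mul_le_mul_left ?_ hN0
  rw [mul_one, mul_add, mul_add]
  linarith

/-! ### Comparison of the laws under two communities -/

lemma LLRBoundedBy.expMoment_add_sub_le {Ω : Type*} [MeasurableSpace Ω] {P Q : Measure Ω}
    [IsProbabilityMeasure P] [IsProbabilityMeasure Q] (h : LLRBoundedBy P Q B) {u v : ℝ}
    (hu : u = 0 ∨ u = 1) (hv : v = 0 ∨ v = 1) :
    expMoment P Q (u + (u - v)) ≤ ENNReal.ofReal (Real.exp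
      (4 * cumulantConst B * (u + v - 2 * (u * v)) * (klDiv P Q).toReal)) := by
  have hC := one_le_cumulantConst h.nonneg
  have hk : 0 ≤ (klDiv P Q).toReal := ENNReal.toReal_nonneg
  -- The weight `2u - v` is `0`, `-1`, `2` or `1`. Weights `0` and `1` have moment one; the others
  -- are `1 + t` with `t = -2` and `t = 1`, and `C ≥ 1` absorbs the linear term.
  rcases hu with rfl | rfl <;> rcases hv with rfl | rfl
  · simp
  · have := h.expMoment_le (t := -2) (by norm_num)
    norm_num at this ⊢
    refine this.trans ?_
    gcongr
    linarith
  · rw [sub_zero]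
    refine (h.expMoment_le (t := 1) (by norm_num)).trans ?_
    norm_num
    gcongr
    linarith
  · norm_num [h.expMoment_one]

/-- Comparison of the laws given two label vectors. -/
lemma obsKernel_real_le_add (hPQ : LLRBoundedBy (bern p) (bern q) B)
    (hVU : LLRBoundedBy V U B) (x y : Labels n) (τ : ℝ) {A : Set (GraphObs n × SideObs 𝓨 n M)}
    (hA : MeasurableSet A) :
    (obsKernel n M p q V U x).real A ≤ Real.exp τ * (obsKernel n M p q V U y).real A +
      Real.exp (-τ) * Real.exp (4 * cumulantConst B *
        ((∑ e, edgeInd x e + ∑ e, edgeInd y e - 2 * ∑ e, edgeInd (meet x y) e) * edgeKL p q +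
          M * ((size x : ℝ) + size y - 2 * size (meet x y)) * featureKL V U)) := by
  have key : obsKernel n M p q V U x A ≤ ENNReal.ofReal (Real.exp τ) * obsKernel n M p q V U y A +
      ENNReal.ofReal (Real.exp (-τ)) * ENNReal.ofReal (Real.exp (4 * cumulantConst B *
        ((∑ e, edgeInd x e + ∑ e, edgeInd y e - 2 * ∑ e, edgeInd (meet x y) e) * edgeKL p q +
          M * ((size x : ℝ) + size y - 2 * size (meet x y)) * featureKL V U))) := by
    have h1 : ∫⁻ z, ENNReal.ofReal (Real.exp (logLik p q V U x z +
          (logLik p q V U x z - logLik p q V U y z))) ∂nullLaw n M (bern q) U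
        ≤ ENNReal.ofReal (Real.exp (4 * cumulantConst B *
        ((∑ e, edgeInd x e + ∑ e, edgeInd y e - 2 * ∑ e, edgeInd (meet x y) e) * edgeKL p q +
          M * ((size x : ℝ) + size y - 2 * size (meet x y)) * featureKL V U))) := by
      simp only [logLik, ← linStat_sub, ← linStat_add]
      refine (lintegral_exp_linStat_le (D := edgeKL p q) (E := featureKL V U)
        (r := fun e => 4 * cumulantConst B *
          (edgeInd x e + edgeInd y e - 2 * (edgeInd x e * edgeInd y e)))
        (s := fun i => 4 * cumulantConst B *
          (nodeInd x i + nodeInd y i - 2 * (nodeInd x i * nodeInd y i)))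
        (fun e => hPQ.expMoment_add_sub_le (edgeInd_eq_zero_or_one x e) (edgeInd_eq_zero_or_one y e))
        (fun i => hVU.expMoment_add_sub_le (nodeInd_eq_zero_or_one x i) (nodeInd_eq_zero_or_one y i))).trans
        (le_of_eq ?_)
      simp only [← edgeInd_meet, ← nodeInd_meet]
      rw [← Finset.mul_sum, ← Finset.mul_sum, Finset.sum_sub_distrib, Finset.sum_sub_distrib,
        Finset.sum_add_distrib, Finset.sum_add_distrib, ← Finset.mul_sum, ← Finset.mul_sum,
        sum_nodeInd, sum_nodeInd, sum_nodeInd]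
      congr 2
      ring
    calc obsKernel n M p q V U x A
        = ∫⁻ z in A, ENNReal.ofReal (Real.exp (logLik p q V U x z)) ∂nullLaw n M (bern q) U := by
          rw [obsKernel_eq_withDensity hPQ hVU, withDensity_apply _ hA]
      _ ≤ ∫⁻ z in A, (ENNReal.ofReal (Real.exp τ) * ENNReal.ofReal (Real.exp (logLik p q V U y z))
          + ENNReal.ofReal (Real.exp (-τ)) * ENNReal.ofReal (Real.exp (logLik p q V U x z +
          (logLik p q V U x z - logLik p q V U y z)))) ∂nullLaw n M (bern q) U := by
          refine lintegral_mono fun z => ?_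
          rw [← ENNReal.ofReal_mul (Real.exp_pos _).le, ← ENNReal.ofReal_mul (Real.exp_pos _).le,
            ← Real.exp_add, ← Real.exp_add]
          -- If the likelihood ratio of `x` to `y` is at most `exp τ`, the first term suffices;
          -- otherwise multiplying by `exp(-τ)` times that ratio only increases the density, which
          -- leads to its second moment.
          rcases le_total (logLik p q V U x z) (τ + logLik p q V U y z) with h | h
          · exact le_add_right (ENNReal.ofReal_le_ofReal (Real.exp_le_exp.2 h))
          · exact le_add_left (ENNReal.ofReal_le_ofReal (Real.exp_le_exp.2 (by linarith)))
      _ = ENNReal.ofReal (Real.exp τ) * obsKernel n M p q V U y A +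
          ENNReal.ofReal (Real.exp (-τ)) * ∫⁻ z in A, ENNReal.ofReal (Real.exp
          (logLik p q V U x z + (logLik p q V U x z - logLik p q V U y z)))
            ∂nullLaw n M (bern q) U := by
          rw [lintegral_add_left (by fun_prop), lintegral_const_mul _ (by fun_prop),
            lintegral_const_mul _ (by fun_prop), obsKernel_eq_withDensity hPQ hVU,
            withDensity_apply _ hA]
      _ ≤ _ := by
          gcongr
          exact (setLIntegral_le_lintegral _ _).trans h1
  have h2 := ENNReal.toReal_mono (ENNReal.add_ne_top.2
    ⟨ENNReal.mul_ne_top ENNReal.ofReal_ne_top (measure_ne_top _ _),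
      ENNReal.mul_ne_top ENNReal.ofReal_ne_top ENNReal.ofReal_ne_top⟩) key
  rw [ENNReal.toReal_add (ENNReal.mul_ne_top ENNReal.ofReal_ne_top (measure_ne_top _ _))
    (ENNReal.mul_ne_top ENNReal.ofReal_ne_top ENNReal.ofReal_ne_top), ENNReal.toReal_mul,
    ENNReal.toReal_mul, ENNReal.toReal_ofReal (Real.exp_pos _).le,
    ENNReal.toReal_ofReal (Real.exp_pos _).le, ENNReal.toReal_ofReal (Real.exp_pos _).le] at h2
  exact h2

end

end SingleCommunity

namespace SingleCommunity

variable {𝓨 : Type*} [MeasurableSpace 𝓨] {n M : ℕ}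

/-! ### Exchanging a member of the community with a non-member -/

lemma size_comp_swap (x : Labels n) (i j : Fin n) : size (x ∘ Equiv.swap i j) = size x := by
  have h : (size (x ∘ Equiv.swap i j) : ℝ) = size x := by
    rw [← sum_nodeInd, ← sum_nodeInd]
    exact Equiv.sum_comp (Equiv.swap i j) (nodeInd x)
  exact_mod_cast h

lemma size_meet_comp_swap {x : Labels n} {i j : Fin n} (hi : x i = true) (hj : x j = false) :
    (size (meet x (x ∘ Equiv.swap i j)) : ℝ) = size x - 1 := by
  have hij : i ≠ j := by rintro rfl; simp [hi] at hj
  rw [← sum_nodeInd, ← sum_nodeInd, eq_sub_iff_add_eq, ← Finset.sum_ite_eq' Finset.univ i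
    (fun _ => (1 : ℝ)) |>.trans (if_pos (Finset.mem_univ i)), ← Finset.sum_add_distrib]
  refine Finset.sum_congr rfl fun k _ => ?_
  by_cases hki : k = i
  · subst hki
    simp [nodeInd, meet, hi, hj]
  · by_cases hkj : k = j
    · subst hkj
      simp [nodeInd, meet, hj, hki]
    · simp [nodeInd, meet, Equiv.swap_apply_of_ne_of_ne hki hkj, hki]

lemma comp_swap_comp_swap (x : Labels n) (i j : Fin n) :
    (x ∘ Equiv.swap i j) ∘ Equiv.swap i j = x := by
  funext k; simp

lemma sum_communityFinset_comp_swap {K : ℕ} (i j : Fin n) (f : Labels n → ℝ) :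
    ∑ x ∈ communityFinset n K, f (x ∘ Equiv.swap i j) = ∑ x ∈ communityFinset n K, f x := by
  refine Finset.sum_nbij' (fun x => x ∘ Equiv.swap i j) (fun x => x ∘ Equiv.swap i j)
    ?_ ?_ ?_ ?_ ?_
  · intro x hx; simpa [size_comp_swap] using hx
  · intro x hx; simpa [size_comp_swap] using hx
  · intro x _; exact comp_swap_comp_swap x i j
  · intro x _; exact comp_swap_comp_swap x i j
  · intro x _; rfl

lemma sum_one_sub_nodeInd (x : Labels n) : ∑ i, (1 - nodeInd x i) = (n : ℝ) - size x := by
  rw [Finset.sum_sub_distrib, sum_nodeInd]; simp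

section

variable {p q : unitInterval} {V U : Measure 𝓨} [IsProbabilityMeasure V]
  [IsProbabilityMeasure U] {B : ℝ}

/-- Outside the error event at most `εK` nodes are mislabelled; on it the trivial bound `|S|` is
used. -/
lemma sum_real_ne_le (x : Labels n) (S : Finset (Fin n))
    {xhat : GraphObs n × SideObs 𝓨 n M → Labels n} (hx : Measurable xhat) {K : ℕ} (hK : 0 < K)
    {ε : ℝ} (hε : 0 ≤ ε) :
    ∑ i ∈ S, (obsKernel n M p q V U x).real {z | xhat z i ≠ x i} ≤
      ε * K + S.card * (obsKernel n M p q V U x).real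
        {z | ε < (hammingDist (xhat z) x : ℝ) / (K : ℝ)} := by
  classical
  refine sum_measureReal_le _ S (fun i => ?_) ?_ (by positivity) fun z hz => ?_
  · exact hx (MeasurableSet.of_discrete (s := {w | w i ≠ x i}))
  · exact hx (MeasurableSet.of_discrete (s := {w | ε < (hammingDist w x : ℝ) / (K : ℝ)}))
  · have hz' : ¬ ε < (hammingDist (xhat z) x : ℝ) / (K : ℝ) := hz
    rw [not_lt, div_le_iff₀ (by exact_mod_cast hK)] at hz'
    refine le_trans ?_ hz'
    refine (Finset.sum_le_sum_of_subset_of_nonneg (Finset.subset_univ _)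
      fun _ _ _ => Set.indicator_nonneg (fun _ _ => zero_le_one) _).trans (le_of_eq ?_)
    rw [hammingDist, Finset.card_filter, Nat.cast_sum]
    refine Finset.sum_congr rfl fun i _ => ?_
    simp only [Set.indicator_apply, Nat.cast_ite, Nat.cast_one, Nat.cast_zero]
    rfl

/-- An estimator with a small error has to distinguish a member of the community from a
non-member that takes its place. -/
lemma one_sub_error_le {K : ℕ} (hK0 : 0 < K) (hKn : 2 * K ≤ n)
    (hPQ : LLRBoundedBy (bern p) (bern q) B) (hVU : LLRBoundedBy V U B)
    {xhat : GraphObs n × SideObs 𝓨 n M → Labels n} (hx : Measurable xhat) {ε α : ℝ} (hε : 0 ≤ ε)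
    (hα : (jointLaw n K M p q V U).real {z | ε < (hammingDist (xhat z.2) z.1 : ℝ) / (K : ℝ)} = α)
    (τ : ℝ) :
    1 - ε - α ≤ Real.exp τ * (ε + α) + Real.exp (-τ) * Real.exp (8 * cumulantConst B *
      (((K : ℝ) - 1) * edgeKL p q + M * featureKL V U)) := by
  classical
  set R := Real.exp (8 * cumulantConst B *
      (((K : ℝ) - 1) * edgeKL p q + M * featureKL V U)) with hR
  have hKr : (0 : ℝ) < K := by exact_mod_cast hK0
  have hnr : 2 * (K : ℝ) ≤ n := by exact_mod_cast hKn
  have hKn' : K ≤ n := by omega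
  set N : ℝ := ((communityFinset n K).card : ℝ) with hN
  have hN0 : 0 < N := by
    rw [hN]; exact_mod_cast (communityFinset_nonempty hKn').card_pos
  let F : Labels n → Fin n → ℝ := fun x i =>
    (obsKernel n M p q V U x).real {z | xhat z i = true}
  let e : Labels n → ℝ := fun x =>
    (obsKernel n M p q V U x).real {z | ε < (hammingDist (xhat z) x : ℝ) / (K : ℝ)}
  have hmeas : ∀ i, MeasurableSet {z | xhat z i = true} := fun i =>
    hx (MeasurableSet.of_discrete (s := {w : Labels n | w i = true}))
  have he : ∑ x ∈ communityFinset n K, e x = N * α := by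
    rw [← hα, hN, card_mul_jointLaw_real hKn' p q V U (measurableSet_error hx ε)]
    rfl
  have hin : ∀ x ∈ communityFinset n K, K - ε * K - K * e x ≤ ∑ i, nodeInd x i * F x i := by
    intro x hxK
    have hs : size x = K := mem_communityFinset.1 hxK
    have h1 := sum_real_ne_le (p := p) (q := q) (V := V) (U := U) x
      (Finset.univ.filter fun i => x i = true) hx hK0 hε
    have h2 : ∑ i ∈ Finset.univ.filter fun i => x i = true,
        (obsKernel n M p q V U x).real {z | xhat z i ≠ x i}
        = ∑ i, (nodeInd x i - nodeInd x i * F x i) := by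
      rw [Finset.sum_filter]
      refine Finset.sum_congr rfl fun i _ => ?_
      cases hxi : x i
      · simp [nodeInd, hxi]
      · simp only [nodeInd, hxi, if_true, one_mul]
        exact probReal_compl_eq_one_sub (hmeas i)
    rw [h2, Finset.sum_sub_distrib, sum_nodeInd, hs] at h1
    have h3 : ((Finset.univ.filter fun i => x i = true).card : ℝ) = K := by exact_mod_cast hs
    rw [h3] at h1
    linarith
  have hout : ∀ x ∈ communityFinset n K,
      ∑ i, (1 - nodeInd x i) * F x i ≤ ε * K + (n - K) * e x := by
    intro x hxK
    have hs : size x = K := mem_communityFinset.1 hxK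
    have h1 := sum_real_ne_le (p := p) (q := q) (V := V) (U := U) x
      (Finset.univ.filter fun i => x i = false) hx hK0 hε
    have h2 : ∑ i ∈ Finset.univ.filter fun i => x i = false,
        (obsKernel n M p q V U x).real {z | xhat z i ≠ x i}
        = ∑ i, (1 - nodeInd x i) * F x i := by
      rw [Finset.sum_filter]
      refine Finset.sum_congr rfl fun i _ => ?_
      cases hxi : x i
      · simp [nodeInd, hxi, F]
      · simp [nodeInd, hxi]
    have h3 : ((Finset.univ.filter fun i => x i = false).card : ℝ) = n - K := by
      rw [← hs, ← sum_one_sub_nodeInd, Finset.card_filter, Nat.cast_sum]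
      refine Finset.sum_congr rfl fun i _ => ?_
      cases hxi : x i <;> simp [nodeInd, hxi]
    rw [h2, h3] at h1
    exact h1
  -- For a member `i` and a non-member `j`, exchanging them changes `2(K-1)` pairs and the features
  -- of two nodes; hence the constant `8` in `R`.
  have hpt : ∀ x ∈ communityFinset n K, ∀ i j,
      nodeInd x i * (1 - nodeInd x j) * F x i ≤ nodeInd x i * (1 - nodeInd x j) *
        (Real.exp τ * F (x ∘ Equiv.swap i j) i + Real.exp (-τ) * R) := by
    intro x hxK i j
    have hs : size x = K := mem_communityFinset.1 hxK
    cases hxi : x i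
    · simp [nodeInd, hxi]
    cases hxj : x j
    swap
    · simp [nodeInd, hxj]
    simp only [nodeInd, hxi, hxj, if_true, Bool.false_eq_true, if_false, sub_zero, one_mul]
    refine (obsKernel_real_le_add hPQ hVU x (x ∘ Equiv.swap i j) τ (hmeas i)).trans (le_of_eq ?_)
    rw [sum_edgeInd, sum_edgeInd, sum_edgeInd, size_comp_swap, size_meet_comp_swap hxi hxj, hs, hR]
    congr 3
    ring
  have hL : ∑ x ∈ communityFinset n K, ∑ i, ∑ j, nodeInd x i * (1 - nodeInd x j) * F x i
      = (n - K) * ∑ x ∈ communityFinset n K, ∑ i, nodeInd x i * F x i := by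
    rw [Finset.mul_sum]
    refine Finset.sum_congr rfl fun x hxK => ?_
    rw [Finset.mul_sum]
    refine Finset.sum_congr rfl fun i _ => ?_
    rw [← mem_communityFinset.1 hxK, ← sum_one_sub_nodeInd, Finset.sum_mul]
    exact Finset.sum_congr rfl fun j _ => by ring
  have hswap : ∑ x ∈ communityFinset n K, ∑ i, ∑ j,
        nodeInd x i * (1 - nodeInd x j) * F (x ∘ Equiv.swap i j) i
      = K * ∑ x ∈ communityFinset n K, ∑ i, (1 - nodeInd x i) * F x i := by
    -- Reindexing by the exchange preserves the set of communities and turns `i` into a non-member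
    -- and `j` into a member; the sum over `j` then gives the factor `K`.
    have h1 : ∀ i j, ∑ x ∈ communityFinset n K,
        nodeInd x i * (1 - nodeInd x j) * F (x ∘ Equiv.swap i j) i
        = ∑ x ∈ communityFinset n K, nodeInd x j * (1 - nodeInd x i) * F x i := by
      intro i j
      rw [← sum_communityFinset_comp_swap i j]
      refine Finset.sum_congr rfl fun x _ => ?_
      simp [nodeInd, comp_swap_comp_swap]
    calc _ = ∑ i, ∑ j, ∑ x ∈ communityFinset n K,
          nodeInd x i * (1 - nodeInd x j) * F (x ∘ Equiv.swap i j) i := by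
          rw [Finset.sum_comm]
          exact Finset.sum_congr rfl fun i _ => Finset.sum_comm
      _ = ∑ i, ∑ j, ∑ x ∈ communityFinset n K, nodeInd x j * (1 - nodeInd x i) * F x i := by
          simp only [h1]
      _ = ∑ x ∈ communityFinset n K, ∑ i, ∑ j, nodeInd x j * (1 - nodeInd x i) * F x i := by
          symm
          rw [Finset.sum_comm]
          exact Finset.sum_congr rfl fun i _ => Finset.sum_comm
      _ = _ := by
          rw [Finset.mul_sum]
          refine Finset.sum_congr rfl fun x hxK => ?_
          rw [Finset.mul_sum]
          refine Finset.sum_congr rfl fun i _ => ?_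
          rw [← mem_communityFinset.1 hxK, ← sum_nodeInd, Finset.sum_mul]
          exact Finset.sum_congr rfl fun j _ => by ring
  have hconst : ∑ x ∈ communityFinset n K, ∑ i, ∑ j, nodeInd x i * (1 - nodeInd x j)
      = N * (K * (n - K)) := by
    rw [hN, ← nsmul_eq_mul, ← Finset.sum_const]
    refine Finset.sum_congr rfl fun x hxK => ?_
    rw [← Finset.sum_mul_sum, sum_nodeInd, sum_one_sub_nodeInd, mem_communityFinset.1 hxK]
  have hsum : ∑ x ∈ communityFinset n K, ∑ i, ∑ j, nodeInd x i * (1 - nodeInd x j) * F x i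
      ≤ ∑ x ∈ communityFinset n K, ∑ i, ∑ j, nodeInd x i * (1 - nodeInd x j) *
        (Real.exp τ * F (x ∘ Equiv.swap i j) i + Real.exp (-τ) * R) :=
    Finset.sum_le_sum fun x hxK => Finset.sum_le_sum fun i _ => Finset.sum_le_sum fun j _ =>
      hpt x hxK i j
  have hsplit : ∑ x ∈ communityFinset n K, ∑ i, ∑ j, nodeInd x i * (1 - nodeInd x j) *
        (Real.exp τ * F (x ∘ Equiv.swap i j) i + Real.exp (-τ) * R)
      = Real.exp τ * (K * ∑ x ∈ communityFinset n K, ∑ i, (1 - nodeInd x i) * F x i)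
        + Real.exp (-τ) * R * (N * (K * (n - K))) := by
    rw [← hswap, ← hconst]
    simp only [Finset.mul_sum, ← Finset.sum_add_distrib]
    refine Finset.sum_congr rfl fun x _ => Finset.sum_congr rfl fun i _ =>
      Finset.sum_congr rfl fun j _ => by ring
  rw [hL, hsplit] at hsum
  have h1 : N * (K - ε * K - K * α) ≤ ∑ x ∈ communityFinset n K, ∑ i, nodeInd x i * F x i := by
    refine le_trans (le_of_eq ?_) (Finset.sum_le_sum hin)
    rw [Finset.sum_sub_distrib, Finset.sum_const, ← Finset.mul_sum, he, nsmul_eq_mul, ← hN]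
    ring
  have h2 : ∑ x ∈ communityFinset n K, ∑ i, (1 - nodeInd x i) * F x i
      ≤ N * ((n - K) * (ε + α)) := by
    refine (Finset.sum_le_sum hout).trans ?_
    rw [Finset.sum_add_distrib, Finset.sum_const, ← Finset.mul_sum, he, nsmul_eq_mul, ← hN]
    -- Here `2K ≤ n` enters: false positives are rare relative to the number of non-members.
    have : N * (ε * K) ≤ N * (ε * (n - K)) := by gcongr; linarith
    linarith
  have hnK : 0 < (n : ℝ) - K := by linarith
  have h3 : (n - K) * (N * (K - ε * K - K * α)) ≤
      Real.exp τ * (K * (N * ((n - K) * (ε + α)))) + Real.exp (-τ) * R * (N * (K * (n - K))) := by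
    refine (mul_le_mul_of_nonneg_left h1 hnK.le).trans (hsum.trans ?_)
    gcongr
  refine le_of_mul_le_mul_left ?_ (show 0 < N * (K * (n - K)) by positivity)
  linarith

end

end SingleCommunity

namespace SingleCommunity

/-! ### Asymptotics -/

section

variable {K : ℕ → ℕ}

lemma eventually_two_mul_le (hKo : (fun n => (K n : ℝ)) =o[atTop] (fun n => (n : ℝ))) :
    ∀ᶠ n in atTop, 2 * K n ≤ n := by
  filter_upwards [hKo.bound (show (0 : ℝ) < 1 / 2 by norm_num)] with n hn
  rw [RCLike.norm_natCast, RCLike.norm_natCast] at hn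
  have : (2 * K n : ℝ) ≤ n := by linarith
  exact_mod_cast this

lemma tendsto_log_div_atTop (hKo : (fun n => (K n : ℝ)) =o[atTop] (fun n => (n : ℝ)))
    (hK : Tendsto K atTop atTop) :
    Tendsto (fun n : ℕ => Real.log ((n : ℝ) / (K n : ℝ))) atTop atTop := by
  refine Real.tendsto_log_atTop.comp ?_
  have h1 : Tendsto (fun n : ℕ => (K n : ℝ) / n) atTop (𝓝[>] 0) := by
    refine tendsto_nhdsWithin_iff.2 ⟨hKo.tendsto_div_nhds_zero, ?_⟩
    filter_upwards [hK.eventually_ge_atTop 1, eventually_ge_atTop 1] with n h1 h2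
    have : (0 : ℝ) < K n := by exact_mod_cast h1
    have : (0 : ℝ) < n := by exact_mod_cast h2
    exact Set.mem_Ioi.2 (by positivity)
  refine (tendsto_inv_nhdsGT_zero.comp h1).congr fun n => ?_
  simp

end

variable {𝓨 : Type*} [MeasurableSpace 𝓨] {V U : Measure 𝓨}

lemma exists_llrBoundedBy (hLLR : BoundedLLR V U) {p q : ℕ → unitInterval}
    (hqp : ∀ n, q n ≤ p n)
    (hpq : (fun n => (p n : ℝ) / (q n : ℝ)) =Θ[atTop] (fun _ => (1 : ℝ)))
    (hp : limsup (fun n => (p n : ℝ)) atTop < 1) :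
    ∃ B : ℝ, (∀ᶠ n in atTop, LLRBoundedBy (bern (p n)) (bern (q n)) B) ∧
      LLRBoundedBy V U B := by
  obtain ⟨hac, hac', B, hB⟩ := hLLR
  obtain ⟨A, hA⟩ := hpq.1.bound
  obtain ⟨a, ha⟩ := hpq.2.bound
  obtain ⟨r, hr, hr1⟩ := exists_between hp
  have hbdd : IsBoundedUnder (· ≤ ·) atTop fun n => (p n : ℝ) :=
    isBoundedUnder_of ⟨1, fun n => (p n).2.2⟩
  refine ⟨max (max (Real.log A) (-Real.log (1 - r))) B, ?_,
    (LLRBoundedBy.mk hac hac' hB).mono (le_max_right _ _)⟩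
  filter_upwards [hA, ha, eventually_lt_of_limsup_lt hr hbdd] with n h1 h2 h3
  -- If `q n = 0`, the quotient `p n / q n` is `0` by convention, contradicting the lower bound in
  -- `Θ(1)`.
  have hq0 : 0 < (q n : ℝ) := by
    refine lt_of_le_of_ne (q n).2.1 fun h => ?_
    rw [← h] at h2
    norm_num at h2
  refine (llrBoundedBy_bern (A := A) (c := 1 - r) hq0 (hqp n) ?_ (by linarith)
    (by linarith)).mono (le_max_left _ _)
  rw [norm_one, mul_one, Real.norm_eq_abs, abs_of_nonneg (div_nonneg (p n).2.1 hq0.le),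
    div_le_iff₀ hq0] at h1
  exact h1

variable [IsProbabilityMeasure V] [IsProbabilityMeasure U]
  {K M : ℕ → ℕ} {p q : ℕ → unitInterval} {B : ℝ}

/-! ### Sufficiency and necessity in the limit -/

lemma two_pow_le_exp (k : ℕ) : (2 : ℝ) ^ k ≤ Real.exp k := by
  rw [← Real.exp_one_pow]
  exact pow_le_pow_left₀ zero_le_two (by linarith [Real.add_one_le_exp (1 : ℝ)]) k

lemma weakRecoveryAchievable_of_lt (hPQ : ∀ᶠ n in atTop, LLRBoundedBy (bern (p n)) (bern (q n)) B)
    (hVU : LLRBoundedBy V U B) (hKn : ∀ n, K n ≤ n)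
    (hKo : (fun n => (K n : ℝ)) =o[atTop] (fun n => (n : ℝ))) (hK : Tendsto K atTop atTop)
    (hT : Tendsto (fun n => ((K n : ℝ) - 1) * edgeKL (p n) (q n)
          + (M n : ℝ) * featureKL V U) atTop atTop)
    (hR : 2 < liminf (fun n => (((((K n : ℝ) - 1) * edgeKL (p n) (q n)
          + 2 * (M n : ℝ) * featureKL V U)
            / Real.log ((n : ℝ) / (K n : ℝ)) : ℝ) : EReal)) atTop) :
    WeakRecoveryAchievable K M p q V U := by
  have hC := one_le_cumulantConst hVU.nonneg
  have hlog := tendsto_log_div_atTop hKo hK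
  obtain ⟨c, hc2, hc⟩ := EReal.lt_iff_exists_real_btwn.1 hR
  have hc2' : (2 : ℝ) < c := EReal.coe_lt_coe_iff.1 hc2
  choose xhat hmeas hmle using fun n => exists_measurable_argmax (hKn n)
    (logLik (M := M n) (p n) (q n) V U) (fun x => measurable_linStat _ _ _ _ _ _)
  refine ⟨xhat, hmeas, fun ε hε => ?_⟩
  -- `η` and `δ` share the slack in `c > 2` so that `(1 - η) c / 2 = 1 + δ`.
  set η := (c - 2) / (2 * c) with hη
  set δ := (c - 2) / 4 with hδ
  have hη0 : 0 < η := by rw [hη]; apply div_pos <;> linarith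
  have hη1 : η ≤ 1 := by rw [hη, div_le_one (by linarith)]; linarith
  have hδ0 : 0 < δ := by rw [hδ]; linarith
  have hlim : Tendsto (fun n => ENNReal.ofReal (2 * Real.exp (-(K n : ℝ)))) atTop (𝓝 0) := by
    rw [← ENNReal.ofReal_zero]
    refine ENNReal.tendsto_ofReal ?_
    rw [← mul_zero (2 : ℝ)]
    exact (Real.tendsto_exp_neg_atTop_nhds_zero.comp
      (tendsto_natCast_atTop_atTop.comp hK)).const_mul 2
  refine tendsto_of_tendsto_of_tendsto_of_le_of_le' tendsto_const_nhds hlim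
    (Eventually.of_forall fun _ => zero_le) ?_
  -- The two thresholds make the exponents at least `3K` (noise) and `2K` (signal), which beat `2^K
  -- e^K` and `2^K` and leave `exp(-K)` each.
  filter_upwards [hPQ, hK.eventually_ge_atTop 1, eventually_lt_of_lt_liminf hc,
    hlog.eventually_ge_atTop (6 / (δ * ε)), hlog.eventually_gt_atTop 0,
    hT.eventually_ge_atTop (32 * cumulantConst B / (η ^ 2 * ε))] with n h1 h2 h3 h4 h5 h6
  set Λ := Real.log ((n : ℝ) / (K n : ℝ)) with hΛ
  have hK0 : (0 : ℝ) < K n := by exact_mod_cast h2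
  have hn0 : (0 : ℝ) < n := hK0.trans_le (by exact_mod_cast hKn n)
  rw [EReal.coe_lt_coe_iff, lt_div_iff₀ h5] at h3
  have hexp : Real.exp (-Λ) * n = K n := by
    rw [Real.exp_neg, hΛ, Real.exp_log (by positivity)]; field_simp
  refine jointLaw_error_le (hKn n) _ _ _ _ (hmeas n) ε fun x hx => ?_
  rw [← hx] at h2 h3 h6 hexp hK0 ⊢
  have hRn : (1 + δ) * Λ ≤ (1 - η) / 2 * (((size x : ℝ) - 1) * edgeKL (p n) (q n)
      + 2 * (M n) * featureKL V U) := by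
    have e1 : (1 + δ) * Λ = (1 - η) / 2 * (c * Λ) := by
      rw [hδ, hη]
      have : c ≠ 0 := by linarith
      field_simp
      ring
    rw [e1]
    exact mul_le_mul_of_nonneg_left h3.le (by linarith)
  refine (obsKernel_error_le h1 hVU (fun z => (hmle n z).1.trans hx.symm)
    (fun z => (hmle n z).2 x hx) h2 hε hη0.le hη1 hδ0.le h5.le hexp.le hRn).trans ?_
  refine ENNReal.ofReal_le_ofReal ?_
  rw [two_mul]
  refine add_le_add ?_ ?_
  · refine (mul_le_mul_of_nonneg_right (two_pow_le_exp _) (Real.exp_pos _).le).trans ?_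
    rw [← Real.exp_add, Real.exp_le_exp]
    rw [div_le_iff₀ (by positivity)] at h6
    have : 2 * size x ≤ η ^ 2 / (4 * cumulantConst B) * (ε * size x / 4 *
        (((size x : ℝ) - 1) * edgeKL (p n) (q n) + M n * featureKL V U)) := by
      rw [div_mul_eq_mul_div, le_div_iff₀ (by positivity)]
      nlinarith
    linarith
  · rw [mul_assoc]
    refine (mul_le_mul_of_nonneg_right (two_pow_le_exp _) (by positivity)).trans ?_
    rw [← Real.exp_add, ← Real.exp_add, Real.exp_le_exp]
    rw [div_le_iff₀ (by positivity)] at h4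
    nlinarith

lemma tendsto_info_of_weakRecovery
    (hPQ : ∀ᶠ n in atTop, LLRBoundedBy (bern (p n)) (bern (q n)) B)
    (hVU : LLRBoundedBy V U B)
    (hKo : (fun n => (K n : ℝ)) =o[atTop] (fun n => (n : ℝ))) (hK : Tendsto K atTop atTop)
    (h : WeakRecoveryAchievable K M p q V U) :
    Tendsto (fun n => ((K n : ℝ) - 1) * edgeKL (p n) (q n)
          + (M n : ℝ) * featureKL V U) atTop atTop := by
  have hC := one_le_cumulantConst hVU.nonneg
  obtain ⟨xhat, hmeas, herr⟩ := h
  refine tendsto_atTop.2 fun b => ?_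
  -- With this `τ` and `ε = exp(-τ)/8` the false positive term is at most `1/4`, so the second
  -- moment term is at least `1/2 ≥ exp(-1)`, which forces the information above `b`.
  set τ := max (8 * cumulantConst B * b + 1) 0 with hτ
  have hτ0 : 0 ≤ τ := le_max_right _ _
  have hτ1 : 8 * cumulantConst B * b + 1 ≤ τ := le_max_left _ _
  set ε := Real.exp (-τ) / 8 with hε
  have hε0 : 0 < ε := by positivity
  have hε1 : ε ≤ 1 / 8 := by
    have : Real.exp (-τ) ≤ 1 := Real.exp_le_one_iff.2 (by linarith)
    rw [hε]; linarith
  have hα := (ENNReal.tendsto_toReal ENNReal.zero_ne_top).comp (herr ε hε0)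
  filter_upwards [hPQ, hK.eventually_ge_atTop 1, eventually_two_mul_le hKo,
    hα.eventually_le_const (show ENNReal.toReal 0 < ε by simpa using hε0)] with n h1 h2 h3 h4
  have h5 := one_sub_error_le h2 h3 h1 hVU (hmeas n) hε0.le rfl τ
  set α := (jointLaw n (K n) (M n) (p n) (q n) V U).real
    {z | ε < (hammingDist (xhat n z.2) z.1 : ℝ) / (K n : ℝ)} with hαdef
  have h4' : α ≤ ε := h4
  have h6 : Real.exp τ * (ε + α) ≤ 1 / 4 := by
    have : Real.exp τ * (ε + α) ≤ Real.exp τ * (ε + ε) := by gcongr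
    have e1 : Real.exp τ * (ε + ε) = 1 / 4 := by
      rw [hε, Real.exp_neg]; field_simp; norm_num
    linarith
  have h7 : Real.exp (-1) ≤ 1 / 2 := by
    rw [Real.exp_neg, inv_le_comm₀ (Real.exp_pos _) (by norm_num)]
    linarith [Real.add_one_le_exp (1 : ℝ)]
  rw [← Real.exp_add] at h5
  have h8 : -1 ≤ -τ + 8 * cumulantConst B *
      (((K n : ℝ) - 1) * edgeKL (p n) (q n) + M n * featureKL V U) := by
    rw [← Real.exp_le_exp]; linarith
  have h9 : 8 * cumulantConst B * b ≤ 8 * cumulantConst B *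
      (((K n : ℝ) - 1) * edgeKL (p n) (q n) + M n * featureKL V U) := by linarith
  exact le_of_mul_le_mul_left h9 (by linarith)

lemma two_le_liminf_of_weakRecovery
    (hPQ : ∀ᶠ n in atTop, LLRBoundedBy (bern (p n)) (bern (q n)) B)
    (hVU : LLRBoundedBy V U B) (hKn : ∀ n, K n ≤ n)
    (hKo : (fun n => (K n : ℝ)) =o[atTop] (fun n => (n : ℝ))) (hK : Tendsto K atTop atTop)
    (h : WeakRecoveryAchievable K M p q V U) :
    2 ≤ liminf (fun n => (((((K n : ℝ) - 1) * edgeKL (p n) (q n)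
          + 2 * (M n : ℝ) * featureKL V U)
            / Real.log ((n : ℝ) / (K n : ℝ)) : ℝ) : EReal)) atTop := by
  have hC := one_le_cumulantConst hVU.nonneg
  have hT := tendsto_info_of_weakRecovery hPQ hVU hKo hK h
  have hlog := tendsto_log_div_atTop hKo hK
  obtain ⟨xhat, hmeas, herr⟩ := h
  refine le_of_forall_lt fun a ha => ?_
  obtain ⟨c', hac, hc'⟩ := EReal.lt_iff_exists_real_btwn.1 ha
  have hc'2 : c' < 2 := EReal.coe_lt_coe_iff.1 hc'
  -- Truncation at `0` keeps `ε` bounded. Below, `c = 2 - 8ε`, so the losses of order `ε` still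
  -- leave `R ≥ cΛ`.
  set c := max c' 0 with hc
  have hc0 : 0 ≤ c := le_max_right _ _
  have hc2 : c < 2 := max_lt hc'2 zero_lt_two
  refine hac.trans_le (le_trans (EReal.coe_le_coe_iff.2 (le_max_left c' 0)) ?_)
  refine le_liminf_of_le (by isBoundedDefault) ?_
  set ε := (2 - c) / 8 with hε
  have hε0 : 0 < ε := by rw [hε]; linarith
  have hε1 : ε ≤ 1 := by rw [hε]; linarith
  -- Minimizer of `-ε s + C s²`, for the level `θ = (1 + ε) K R / 2`. The first condition, already
  -- proved, makes this tail at most `exp(-2) ≤ 1/4`.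
  set s := ε / (2 * cumulantConst B) with hs
  have hs0 : 0 ≤ s := by positivity
  have hs2 : s ≤ 2 := by rw [hs, div_le_iff₀ (by positivity)]; nlinarith
  have hα := (ENNReal.tendsto_toReal ENNReal.zero_ne_top).comp (herr ε hε0)
  filter_upwards [hPQ, hK.eventually_ge_atTop 1,
    hα.eventually_le_const (show ENNReal.toReal 0 < 1 / 4 by norm_num),
    hlog.eventually_ge_atTop (2 / ε), hlog.eventually_gt_atTop 0,
    hT.eventually_ge_atTop (16 * cumulantConst B / ε ^ 2)] with n h1 h2 h3 h4 h5 h6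
  set Λ := Real.log ((n : ℝ) / (K n : ℝ)) with hΛ
  set R := ((K n : ℝ) - 1) * edgeKL (p n) (q n) + 2 * (M n : ℝ) * featureKL V U with hR
  have hK1 : (1 : ℝ) ≤ K n := by exact_mod_cast h2
  have hTR : ((K n : ℝ) - 1) * edgeKL (p n) (q n) + (M n : ℝ) * featureKL V U ≤ R := by
    have : 0 ≤ (M n : ℝ) * featureKL V U := mul_nonneg (by positivity) featureKL_nonneg
    rw [hR]; linarith
  have h7 := one_le_error_add (ε := ε) h2 (hKn n) h1 hVU (hmeas n)
    ((1 + ε) * (K n / 2 * R)) hs0 hs2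
  have h3' : (jointLaw n (K n) (M n) (p n) (q n) V U).real
    {z | ε < (hammingDist (xhat n z.2) z.1 : ℝ) / (K n : ℝ)} ≤ 1 / 4 := h3
  have hquarter : Real.exp (-2) ≤ 1 / 4 := by
    have e2 : Real.exp 1 * Real.exp 1 = Real.exp 2 := by rw [← Real.exp_add]; norm_num
    rw [Real.exp_neg, inv_le_comm₀ (Real.exp_pos _) (by norm_num), ← e2]
    nlinarith [Real.add_one_le_exp (1 : ℝ)]
  have h8 : Real.exp (-(s * ((1 + ε) * (K n / 2 * R))) +
      (s + cumulantConst B * s ^ 2) * (K n / 2 * R)) ≤ 1 / 4 := by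
    refine le_trans (Real.exp_le_exp.2 ?_) hquarter
    have e1 : -(s * ((1 + ε) * (K n / 2 * R))) + (s + cumulantConst B * s ^ 2) * (K n / 2 * R)
        = -(ε ^ 2 / (4 * cumulantConst B) * (K n / 2 * R)) := by
      rw [hs]; field_simp; ring
    have e3 : 16 * cumulantConst B / ε ^ 2 / 2 ≤ K n / 2 * R := by
      have : 16 * cumulantConst B / ε ^ 2 ≤ R := h6.trans hTR
      have h0 : 0 ≤ R := le_trans (by positivity) this
      nlinarith
    have e4 : ε ^ 2 / (4 * cumulantConst B) * (16 * cumulantConst B / ε ^ 2 / 2) = 2 := by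
      field_simp; norm_num
    have e5 : ε ^ 2 / (4 * cumulantConst B) * (16 * cumulantConst B / ε ^ 2 / 2)
        ≤ ε ^ 2 / (4 * cumulantConst B) * (K n / 2 * R) := by gcongr
    rw [e1]; linarith
  -- The error and the tail take at most `1/4` each, so the volume term is at least `1/2`, hence at
  -- least `exp(-2)`.
  have h9 : -2 ≤ (1 + ε) * (K n / 2 * R) + ε * K n * Λ + K n - K n * Λ := by
    rw [← Real.exp_le_exp]; linarith
  rw [EReal.coe_le_coe_iff, le_div_iff₀ h5]
  have h10 : -2 * (K n : ℝ) ≤ (1 + ε) * (K n / 2 * R) + ε * K n * Λ + K n - K n * Λ := by linarith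
  have h11 : (1 - ε) * Λ - 3 ≤ (1 + ε) / 2 * R := by
    refine le_of_mul_le_mul_left ?_ (show (0 : ℝ) < K n by linarith)
    linarith
  rw [div_le_iff₀ hε0] at h4
  have h12 : c = 2 - 8 * ε := by rw [hε]; ring
  have h13 : (1 - 5 / 2 * ε) * Λ ≤ (1 + ε) / 2 * R := by linarith
  have h14 : (1 + ε) * ((2 - 8 * ε) * Λ) ≤ 2 * ((1 - 5 / 2 * ε) * Λ) := by
    nlinarith [mul_pos hε0 h5, mul_pos (mul_pos hε0 hε0) h5]
  have h15 : (1 + ε) * ((2 - 8 * ε) * Λ) ≤ (1 + ε) * R := by linarith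
  have h16 := le_of_mul_le_mul_left h15 (by linarith)
  change c * Λ ≤ R
  rw [h12]
  exact h16

end SingleCommunity

theorem theorem1 {𝓨 : Type*} [MeasurableSpace 𝓨]
    (V U : Measure 𝓨) [IsProbabilityMeasure V] [IsProbabilityMeasure U]
    (hLLR : SingleCommunity.BoundedLLR V U)
    (K M : ℕ → ℕ) (p q : ℕ → unitInterval)
    (hKn : ∀ n, K n ≤ n)
    (hKo : (fun n => (K n : ℝ)) =o[atTop] (fun n => (n : ℝ)))
    (hK : Tendsto K atTop atTop)
    (hqp : ∀ n, q n ≤ p n)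
    (hpq : (fun n => (p n : ℝ) / (q n : ℝ)) =Θ[atTop] (fun _ => (1 : ℝ)))
    (hp : limsup (fun n => (p n : ℝ)) atTop < 1) :
    -- sufficiency
    ((Tendsto (fun n => ((K n : ℝ) - 1) * SingleCommunity.edgeKL (p n) (q n)
          + (M n : ℝ) * SingleCommunity.featureKL V U) atTop atTop ∧
        2 < liminf (fun n => (((((K n : ℝ) - 1) * SingleCommunity.edgeKL (p n) (q n)
          + 2 * (M n : ℝ) * SingleCommunity.featureKL V U)
            / Real.log ((n : ℝ) / (K n : ℝ)) : ℝ) : EReal)) atTop) →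
      SingleCommunity.WeakRecoveryAchievable K M p q V U) ∧
    -- necessity
    (SingleCommunity.WeakRecoveryAchievable K M p q V U →
      (Tendsto (fun n => ((K n : ℝ) - 1) * SingleCommunity.edgeKL (p n) (q n)
          + (M n : ℝ) * SingleCommunity.featureKL V U) atTop atTop ∧
        2 ≤ liminf (fun n => (((((K n : ℝ) - 1) * SingleCommunity.edgeKL (p n) (q n)
          + 2 * (M n : ℝ) * SingleCommunity.featureKL V U)
            / Real.log ((n : ℝ) / (K n : ℝ)) : ℝ) : EReal)) atTop)) := by
  obtain ⟨B, hPQ, hVU⟩ := SingleCommunity.exists_llrBoundedBy hLLR hqp hpq hp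
  exact ⟨fun h => SingleCommunity.weakRecoveryAchievable_of_lt hPQ hVU hKn hKo hK h.1 h.2,
    fun h => ⟨SingleCommunity.tendsto_info_of_weakRecovery hPQ hVU hKo hK h,
      SingleCommunity.two_le_liminf_of_weakRecovery hPQ hVU hKn hKo hK h⟩⟩
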